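/- An arena $\mathcal{A}=(V,V_0,V_1,E)$ is a finite directed graph $(V,E)$ in which every vertex has an outgoing edge, together with a partition $\{V_0,V_1\}$ of $V$ into the positions of Player $0$ and Player $1$. A game is an arena with a set $\mathrm{Win}\subseteq V^\omega$; a play (infinite path) is won by Player $0$ if it lies in $\mathrm{Win}$ and by Player $1$ otherwise. A strategy for Player $i$ maps every word $wv\in V^*V_i$ to a successor of $v$; it is winning from $W\subseteq V$ if every play that starts in $W$ and is consistent with it is won by Player $i$. The winning region $W_i$ is the set of vertices from which Player $i$ has a winning strategy, and a strategy of Player $i$ is a uniform winning strategy if it is winning from $W_i$. A strategy is finite-state of size $s$ if it is implemented by a set $M$ of $s$ memory states, an initialization $\mathrm{Init}\colon V\to M$, an update function $\mathrm{Upd}\colon M\times V\to M$ and a next-move function $\mathrm{Nxt}\colon V_i\times M\to V$, i.e., it plays $\mathrm{Nxt}(\rho_n,m_n)$ after $\rho_0\cdots\rho_n$, where $m_0=\mathrm{Init}(\rho_0)$ and $m_{j+1}=\mathrm{Upd}(m_j,\rho_{j+1})$. Let $\Gamma=(Q_c,P_c)_{c\in[d]}$ be $d$ pairs of subsets of $V$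 and let $\overline{\mathrm{Cst}}=(\mathrm{Cst}_c)_{c\in[d]}$ be $d$ labellings of the edges by $\epsilon$ or $i$ (increment); $\mathrm{Cst}_c(\rho_k\cdots\rho_{k'})$ denotes the number of edges labelled $i$ by $\mathrm{Cst}_c$ on $\rho_k\cdots\rho_{k'}$. For $\rho\in V^\omega$ and $k\in\mathbb{N}$ let $\mathrm{StCor}_{\mathrm{Cst}_c}(\rho,k)=0$ if $\rho_k\notin Q_c$, and otherwise $\mathrm{StCor}_{\mathrm{Cst}_c}(\rho,k)=\min\{\mathrm{Cst}_c(\rho_k\cdots\rho_{k'})\mid k'\ge k,\ \rho_{k'}\in P_c\}$, where $\min\emptyset=\infty$; let $\mathrm{StCor}_{\overline{\mathrm{Cst}}}(\rho,k)=\max_{c\in[d]}\mathrm{StCor}_{\mathrm{Cst}_c}(\rho,k)$ (which is $0$ if $d=0$). A request at position $k$ is unanswered with cost $\infty$ if for some $c$ with $\rho_k\in Q_c$ there is no $k'\ge k$ with $\rho_{k'}\in P_c$, and infinitely many edges labelled $i$ by $\mathrm{Cst}_c$ are traversed after position $k$. A Streett game with costs has the winning condition $$\mathrm{CostStreett}(\Gamma,\overline{\mathrm{Cst}})=\{\rho\mid\limsup_{k\to\infty}\mathrm{StCor}_{\overline{\mathrm{Cst}}}(\rho,k)<\infty\},$$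 and a bounded Streett game with costs has the winning condition $\mathrm{BndCostStreett}(\Gamma,\overline{\mathrm{Cst}})$ consisting of those $\rho\in\mathrm{CostStreett}(\Gamma,\overline{\mathrm{Cst}})$ in which no request is unanswered with cost $\infty$. For every arena, every $d\ge 0$, every $\Gamma$ and every $\overline{\mathrm{Cst}}$ as above: 1. In the bounded Streett game with costs, Player $0$ has a uniform finite-state winning strategy of size $2^d\cdot(2d)!$. 2. In the Streett game with costs, Player $0$ has a uniform finite-state winning strategy of size $2^d\cdot(2d)!$. 3. In the bounded Streett game with costs, Player $1$ has a uniform finite-state winning strategy of size $2^d$. -/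

import Mathlib

namespace StreettCosts

/-- The two players. -/
inductive Player where
  | zero
  | one

/-- An arena with vertex set `V` (assumed finite in the theorem): a directed graph without
terminal vertices, whose vertices are partitioned between the two players by `owner`. -/
structure Arena (V : Type*) where
  owner : V → Player
  edge : V → V → Prop
  exists_edge : ∀ v, ∃ v', edge v v'

/-- A game: an arena and the set of infinite vertex sequences that are winning for Player 0. -/
structure Game (V : Type*) where
  arena : Arena V
  win : Set (ℕ → V)

/-- Infinite paths through the arena. -/
def Arena.IsPlay {V : Type*} (A : Arena V) (ρ : ℕ → V) : Prop :=
  ∀ n, A.edge (ρ n) (ρ (n + 1))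

/-- Player 0 wins the sequences in `win`, Player 1 wins all others. -/
def Game.WonBy {V : Type*} (G : Game V) (i : Player) (ρ : ℕ → V) : Prop :=
  match i with
  | .zero => ρ ∈ G.win
  | .one => ρ ∉ G.win

/-- A strategy for Player `i`: `move w v` is the choice after the history `w v`, where `w` is a
finite word over `V` and `v` is the current vertex. The values of `move w v` at vertices `v` that
do not belong to Player `i` are irrelevant. -/
structure Strategy {V : Type*} (A : Arena V) (i : Player) where
  move : List V → V → V
  legal : ∀ w v, A.owner v = i → A.edge v (move w v)

/-- `ρ` is consistent with `σ`: at every position `n` owned by Player `i`, the next vertex is the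
one that `σ` prescribes after `ρ 0, …, ρ n`. -/
def Strategy.Consistent {V : Type*} {A : Arena V} {i : Player} (σ : Strategy A i)
    (ρ : ℕ → V) : Prop :=
  ∀ n, A.owner (ρ n) = i → ρ (n + 1) = σ.move ((List.range n).map ρ) (ρ n)

/-- `σ` is a winning strategy for Player `i` from the set `W`. -/
def Game.IsWinningFrom {V : Type*} (G : Game V) {i : Player} (σ : Strategy G.arena i)
    (W : Set V) : Prop :=
  ∀ ρ : ℕ → V, G.arena.IsPlay ρ → ρ 0 ∈ W → σ.Consistent ρ → G.WonBy i ρ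

/-- The winning region of Player `i`. -/
def Game.winningRegion {V : Type*} (G : Game V) (i : Player) : Set V :=
  {v | ∃ σ : Strategy G.arena i, G.IsWinningFrom σ {v}}

/-- A strategy is uniform (winning) if it is winning from the whole winning region. -/
def Game.IsUniformWinning {V : Type*} (G : Game V) {i : Player} (σ : Strategy G.arena i) : Prop :=
  G.IsWinningFrom σ (G.winningRegion i)

/-- A memory structure with set `M` of memory states. -/
structure MemoryStructure (V : Type*) (M : Type*) where
  init : V → M
  upd : M → V → M

/-- The memory state `Upd⁺(w v)` reached after the nonempty word `w v`. -/
def MemoryStructure.updPlus {V M : Type*} (S : MemoryStructure V M) : List V → V → M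
  | [], v => S.init v
  | a :: w, v => S.upd (w.foldl S.upd (S.init a)) v

/-- A next-move function for Player `i`; values at vertices of the opponent are irrelevant. -/
structure NextMove {V : Type*} (A : Arena V) (i : Player) (M : Type*) where
  next : V → M → V
  legal : ∀ v m, A.owner v = i → A.edge v (next v m)

/-- The strategy implemented by a memory structure and a next-move function. -/
def MemoryStructure.strategy {V M : Type*} {A : Arena V} {i : Player} (S : MemoryStructure V M)
    (f : NextMove A i M) : Strategy A i where
  move w v := f.next v (S.updPlus w v)
  legal w v h := f.legal v (S.updPlus w v) h

/-- Player `i` has a uniform finite-state winning strategy of size `n`, that is, one that is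
implemented by a memory structure with exactly `n` memory states. -/
def Game.HasUniformFiniteStateWinningStrategy {V : Type*} (G : Game V) (i : Player)
    (n : ℕ) : Prop :=
  ∃ (M : Type) (_ : Fintype M) (S : MemoryStructure V M) (f : NextMove G.arena i M),
    Fintype.card M = n ∧ G.IsUniformWinning (S.strategy f)

/-- Edge labels: `ε`-edges and increment-edges. -/
inductive Label where
  | eps
  | inc

/-- The number of increments that an edge with the given label contributes. -/
def Label.weight : Label → ℕ
  | .eps => 0
  | .inc => 1

/-- A cost function labels edges. For convenience all pairs of vertices carry a label; plays only
ever use the labels of edges of the arena. -/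
abbrev CostFunction (V : Type*) := V → V → Label

/-- `Cst(ρ_k ⋯ ρ_{k'})`: the number of increment-edges traversed from position `k` to `k'`. -/
def infixCost {V : Type*} (cst : CostFunction V) (ρ : ℕ → V) (k k' : ℕ) : ℕ :=
  ∑ j ∈ Finset.Ico k k', (cst (ρ j) (ρ (j + 1))).weight

/-- A collection of `d` Streett pairs, each of a set of requests and a set of responses. -/
structure StreettPairs (V : Type*) (d : ℕ) where
  Q : Fin d → Set V
  P : Fin d → Set V

open Classical in
/-- The cost-of-response of the pair `c` at position `k`. -/
noncomputable def stCorPair {V : Type*} {d : ℕ} (Γ : StreettPairs V d)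
    (cst : Fin d → CostFunction V) (ρ : ℕ → V) (c : Fin d) (k : ℕ) : ℕ∞ :=
  if ρ k ∈ Γ.Q c then
    ⨅ (k' : ℕ) (_ : k ≤ k' ∧ ρ k' ∈ Γ.P c), (infixCost (cst c) ρ k k' : ℕ∞)
  else 0

/-- The cost-of-response at position `k`: the maximum over all pairs. -/
noncomputable def stCor {V : Type*} {d : ℕ} (Γ : StreettPairs V d)
    (cst : Fin d → CostFunction V) (ρ : ℕ → V) (k : ℕ) : ℕ∞ :=
  ⨆ c, stCorPair Γ cst ρ c k

/-- Some request at position `k` is unanswered with cost `∞`: it belongs to a pair `c`, it is never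
answered, and infinitely many increment-edges of the cost function of `c` follow. -/
def UnansweredWithInfiniteCost {V : Type*} {d : ℕ} (Γ : StreettPairs V d)
    (cst : Fin d → CostFunction V) (ρ : ℕ → V) (k : ℕ) : Prop :=
  ∃ c, ρ k ∈ Γ.Q c ∧ stCorPair Γ cst ρ c k = ⊤ ∧
    {j | k ≤ j ∧ cst c (ρ j) (ρ (j + 1)) = Label.inc}.Infinite

/-- The cost-Streett condition. -/
def costStreett {V : Type*} {d : ℕ} (Γ : StreettPairs V d)
    (cst : Fin d → CostFunction V) : Set (ℕ → V) :=
  {ρ | Filter.limsup (stCor Γ cst ρ) Filter.atTop < ⊤}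

/-- The bounded cost-Streett condition. -/
def bndCostStreett {V : Type*} {d : ℕ} (Γ : StreettPairs V d)
    (cst : Fin d → CostFunction V) : Set (ℕ → V) :=
  {ρ | Filter.limsup (stCor Γ cst ρ) Filter.atTop < ⊤ ∧
    ∀ k, ¬ UnansweredWithInfiniteCost Γ cst ρ k}

/-- Streett games with costs. -/
def streettGameWithCosts {V : Type*} {d : ℕ} (A : Arena V) (Γ : StreettPairs V d)
    (cst : Fin d → CostFunction V) : Game V :=
  ⟨A, costStreett Γ cst⟩

/-- Bounded Streett games with costs. -/
def boundedStreettGameWithCosts {V : Type*} {d : ℕ} (A : Arena V) (Γ : StreettPairs V d)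
    (cst : Fin d → CostFunction V) : Game V :=
  ⟨A, bndCostStreett Γ cst⟩

end StreettCosts

/-! The cost conditions are replaced by an ω-regular condition, the relaxed Streett condition. On
vertices paired with the set of open requests it has `2d` pairs. For each `c`, infinitely many
`c`-increments require that `c` is infinitely often not open, and infinitely many visits to `Q c`
require infinitely many visits to `P c`. Every sequence in the bounded condition satisfies it
(`mem_relaxedStreett_of_mem_bndCostStreett`). The converse fails for single sequences but holds for
plays of a finite-memory strategy. If such a play collected more `c`-increments than there are
states while `c` is open, a state would repeat, and looping there would violate the relaxed
condition (`MemWin.infixCost_le`).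

The engine is `exists_posWin_compl_streettSeq`: in a finite arena, a player who wants to violate a
Streett condition needs no memory. The proof deletes edges at a vertex with several choices. If both
subarenas leave it to the Streett player, her two strategies are interleaved, which is sound because
the interleaving of two sequences that satisfy a Streett condition satisfies it as well.

Player 1 wants to violate the relaxed condition, so the `2^d` sets of open requests suffice as
memory. For Player 0, a ranking of the `2d` pairs is added, an index appearance record. In terms of
ranks, the Streett condition becomes the complement of another Streett condition
(`streett_iff_not_rank`), so she is positional in the extended product. This gives memory `2^d *
(2d)!`. No determinacy theorem is invoked, since strategies for both players meet in a common play.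

In the unbounded game, if Player 0 wins from a vertex, then some vertex reachable from it is winning
for her in the bounded game (`exists_mem_winningRegion_bounded`). Otherwise requests of ever larger
cost could be chained into one losing play. A maximal set won with the given memory must then
contain her whole winning region: in the arena restricted to its complement a bounded winning set
would exist, and it could be added without further memory (`MemWin.extend`), because the cost
condition is prefix-independent. -/

open Filter

namespace StreettCosts

universe u w w'

/-! ### Strategy graphs and positional winning sets. -/

/-- A nondeterministic strategy of Player `p`, presented as a graph of states. -/
structure StratGraph {V : Type u} (A : Arena V) (p : Player) (α : Type w) where
  pos : α → V
  step : α → α → Prop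
  edge_of_step : ∀ a b, step a b → A.edge (pos a) (pos b)
  own : ∀ a, A.owner (pos a) = p → ∃ b, step a b
  opp : ∀ a, A.owner (pos a) ≠ p → ∀ v, A.edge (pos a) v → ∃ b, step a b ∧ pos b = v

/-- Infinite paths through a strategy graph. -/
def StratGraph.IsPath {V : Type u} {A : Arena V} {p : Player} {α : Type w} (g : StratGraph A p α)
    (x : ℕ → α) : Prop :=
  ∀ n, g.step (x n) (x (n + 1))

/-- All infinite paths of the strategy graph trace a sequence in `Win`. -/
def StratGraph.Wins {V : Type u} {A : Arena V} {p : Player} {α : Type w} (g : StratGraph A p α)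
    (Win : Set (ℕ → V)) : Prop :=
  ∀ x, g.IsPath x → (fun n => g.pos (x n)) ∈ Win

theorem Player.eq_of_ne {p q r : Player} (hpq : p ≠ q) (h : r ≠ p) : r = q := by
  cases p <;> cases q <;> cases r <;> simp_all

/-- A relation in which every element has a successor has infinite paths. -/
theorem exists_path_of_forall_exists {α : Type w} (r : α → α → Prop) (h : ∀ a, ∃ b, r a b)
    (a : α) : ∃ x : ℕ → α, x 0 = a ∧ ∀ n, r (x n) (x (n + 1)) := by
  choose f hf using h
  refine ⟨fun n => f^[n] a, rfl, fun n => ?_⟩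
  simp only [Function.iterate_succ_apply']
  exact hf _

/-- Strategy graphs of opposing players that start in the same vertex share a play. -/
theorem StratGraph.exists_common_path {V : Type u} {A : Arena V} {p q : Player} (hpq : p ≠ q)
    {α : Type w} {β : Type w'} (g : StratGraph A p α) (h : StratGraph A q β) {a : α} {b : β}
    (hab : g.pos a = h.pos b) :
    ∃ x y, x 0 = a ∧ y 0 = b ∧ g.IsPath x ∧ h.IsPath y ∧ ∀ n, g.pos (x n) = h.pos (y n) := by
  obtain ⟨z, hz0, hz⟩ := exists_path_of_forall_exists
    (α := {s : α × β // g.pos s.1 = h.pos s.2})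
    (fun s t => g.step s.1.1 t.1.1 ∧ h.step s.1.2 t.1.2) (by
      rintro ⟨⟨a, b⟩, hs⟩
      simp only at hs
      by_cases ho : A.owner (g.pos a) = p
      · obtain ⟨a', ha'⟩ := g.own a ho
        obtain ⟨b', hb', hb''⟩ := h.opp b (by rw [← hs, ho]; exact hpq) (g.pos a')
          (by rw [← hs]; exact g.edge_of_step _ _ ha')
        exact ⟨⟨(a', b'), hb''.symm⟩, ha', hb'⟩
      · obtain ⟨b', hb'⟩ := h.own b (by rw [← hs]; exact Player.eq_of_ne hpq ho)
        obtain ⟨a', ha', ha''⟩ := g.opp a ho (h.pos b')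
          (by rw [hs]; exact h.edge_of_step _ _ hb')
        exact ⟨⟨(a', b'), ha''⟩, ha', hb'⟩) ⟨(a, b), hab⟩
  refine ⟨fun n => (z n).1.1, fun n => (z n).1.2, by simp [hz0], by simp [hz0],
    fun n => (hz n).1, fun n => (hz n).2, fun n => (z n).2⟩

/-- Player `p` wins `Win` from every vertex of `W` with the positional strategy `f`, without
leaving `W`. -/
structure PosWin {V : Type u} (A : Arena V) (p : Player) (f : V → V) (W : Set V)
    (Win : Set (ℕ → V)) : Prop where
  own : ∀ v ∈ W, A.owner v = p → A.edge v (f v) ∧ f v ∈ W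
  opp : ∀ v ∈ W, A.owner v ≠ p → ∀ u, A.edge v u → u ∈ W
  win : ∀ ρ, (∀ n, ρ n ∈ W) → A.IsPlay ρ → (∀ n, A.owner (ρ n) = p → ρ (n + 1) = f (ρ n)) →
    ρ ∈ Win

/-- The strategy graph of a positional strategy. -/
def PosWin.graph {V : Type u} {A : Arena V} {p : Player} {f : V → V} {W : Set V}
    {Win : Set (ℕ → V)} (h : PosWin A p f W Win) : StratGraph A p W where
  pos v := v
  step v u := A.edge v u ∧ (A.owner v = p → u.1 = f v)
  edge_of_step _ _ h := h.1
  own v hv := ⟨⟨f v, (h.own v v.2 hv).2⟩, (h.own v v.2 hv).1, fun _ => rfl⟩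
  opp v hv u hu := ⟨⟨u, h.opp v v.2 hv u hu⟩, ⟨hu, fun h' => absurd h' hv⟩, rfl⟩

theorem PosWin.graph_wins {V : Type u} {A : Arena V} {p : Player} {f : V → V} {W : Set V}
    {Win : Set (ℕ → V)} (h : PosWin A p f W Win) : h.graph.Wins Win :=
  fun x hx => h.win _ (fun n => (x n).2) (fun n => (hx n).1) (fun n => (hx n).2)

/-- A strategy graph of the opponent that wins the complement avoids the winning set of a
positional strategy. -/
theorem PosWin.pos_notMem {V : Type u} {A : Arena V} {p q : Player} (hpq : p ≠ q) {f : V → V}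
    {W : Set V} {Win : Set (ℕ → V)} (h : PosWin A p f W Winᶜ) {α : Type w}
    {g : StratGraph A q α} (hg : g.Wins Win) (a : α) : g.pos a ∉ W := by
  intro ha
  obtain ⟨x, y, -, -, hx, hy, hxy⟩ :=
    h.graph.exists_common_path hpq g (a := ⟨g.pos a, ha⟩) (b := a) rfl
  have h1 := h.graph_wins x hx
  have h2 := hg y hy
  rw [funext hxy] at h1
  exact h1 h2

/-! ### Positional strategies against a Streett condition. -/

/-- The Streett condition with requests and responses on pairs of consecutive elements. -/
def streettSeq {ι : Type*} {V : Type*} (Req Resp : ι → V → V → Prop) : Set (ℕ → V) :=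
  {ρ | ∀ i, (∃ᶠ n in atTop, Req i (ρ n) (ρ (n + 1))) → ∃ᶠ n in atTop, Resp i (ρ n) (ρ (n + 1))}

theorem frequently_add_iff (P : ℕ → Prop) (k : ℕ) :
    (∃ᶠ n in atTop, P (n + k)) ↔ ∃ᶠ n in atTop, P n := by
  have := Filter.map_add_atTop_eq_nat k
  conv_rhs => rw [← this]
  rw [Filter.frequently_map]

theorem mem_streettSeq_add_iff {ι : Type*} {V : Type*} {Req Resp : ι → V → V → Prop} {ρ : ℕ → V}
    (k : ℕ) : (fun n => ρ (n + k)) ∈ streettSeq Req Resp ↔ ρ ∈ streettSeq Req Resp := by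
  refine forall_congr' fun i => ?_
  rw [← frequently_add_iff (fun n => Req i (ρ n) (ρ (n + 1))) k,
    ← frequently_add_iff (fun n => Resp i (ρ n) (ρ (n + 1))) k]
  simp only [Nat.add_right_comm]

/-- Along a sequence that changes only at times in `T`, the `T`-times enumerate a subsequence
whose steps are exactly the changes. -/
theorem stutter_nth {α : Type*} {T : ℕ → Prop} (hT : {n | T n}.Infinite) {z : ℕ → α}
    (hz : ∀ n, ¬ T n → z (n + 1) = z n) (k : ℕ) :
    z (Nat.nth T (k + 1)) = z (Nat.nth T k + 1) := by
  classical
  have hlt : Nat.nth T k < Nat.nth T (k + 1) := Nat.nth_strictMono hT (Nat.lt_succ_self k)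
  have key : ∀ m, Nat.nth T k + 1 + m ≤ Nat.nth T (k + 1) →
      z (Nat.nth T k + 1 + m) = z (Nat.nth T k + 1) := by
    intro m
    induction m with
    | zero => simp
    | succ m ih =>
      intro hm
      rw [← add_assoc, hz _ _, ih (by omega)]
      intro hTm
      have h1 := Nat.count_strict_mono (p := T) hTm (show Nat.nth T k + 1 + m <
        Nat.nth T (k + 1) by omega)
      have h2 := Nat.count_strict_mono (p := T) (Nat.nth_mem_of_infinite hT k)
        (show Nat.nth T k < Nat.nth T k + 1 + m by omega)
      rw [Nat.count_nth_of_infinite hT] at h1 h2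
      omega
  have := key (Nat.nth T (k + 1) - (Nat.nth T k + 1)) (by omega)
  rwa [Nat.add_sub_cancel' (by omega)] at this

theorem frequently_comp_nth {T P : ℕ → Prop} (h : ∃ᶠ n in atTop, T n ∧ P n) :
    {n | T n}.Infinite ∧ ∃ᶠ k in atTop, P (Nat.nth T k) := by
  classical
  have hT : {n | T n}.Infinite := Nat.frequently_atTop_iff_infinite.1 (h.mono fun n hn => hn.1)
  refine ⟨hT, Filter.frequently_atTop.2 fun k => ?_⟩
  obtain ⟨n, hn, hTn, hPn⟩ := Filter.frequently_atTop.1 h (Nat.nth T k)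
  refine ⟨Nat.count T n, ?_, by rwa [Nat.nth_count hTn]⟩
  rw [← Nat.count_nth_of_infinite hT k]
  exact Nat.count_monotone T hn

theorem frequently_of_comp_nth {T P : ℕ → Prop} (hT : {n | T n}.Infinite)
    (h : ∃ᶠ k in atTop, P (Nat.nth T k)) : ∃ᶠ n in atTop, P n :=
  (Nat.nth_strictMono hT).tendsto_atTop.frequently h

/-- Strategy graphs for two arenas that differ from `A` only in the choices of the opponent at `v`
are interleaved to a strategy graph for `A`. -/
noncomputable def StratGraph.shuffle {V : Type u} {A B₁ B₂ : Arena V} {p q : Player} (hpq : p ≠ q) {v : V}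
    (hv : A.owner v = p) (ho₁ : B₁.owner = A.owner) (ho₂ : B₂.owner = A.owner)
    (he₁ : ∀ u w, B₁.edge u w → A.edge u w) (he₂ : ∀ u w, B₂.edge u w → A.edge u w)
    (hn₁ : ∀ u w, u ≠ v → A.edge u w → B₁.edge u w)
    (hn₂ : ∀ u w, u ≠ v → A.edge u w → B₂.edge u w)
    (hvw : ∀ w, A.edge v w → B₁.edge v w ∨ B₂.edge v w)
    {α : Type w} {β : Type w'} (g : StratGraph B₁ q α) (h : StratGraph B₂ q β) :
    StratGraph A q {s : α × β // g.pos s.1 = v ∨ h.pos s.2 = v} where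
  -- One component is always parked at `v` and the other one is active. When both are at `v`, either
  -- may move.
  pos s := open Classical in if h.pos s.1.2 = v then g.pos s.1.1 else h.pos s.1.2
  step s t := (h.pos s.1.2 = v ∧ g.step s.1.1 t.1.1 ∧ t.1.2 = s.1.2) ∨
    (g.pos s.1.1 = v ∧ h.step s.1.2 t.1.2 ∧ t.1.1 = s.1.1)
  edge_of_step := by
    rintro ⟨⟨a, b⟩, hab⟩ ⟨⟨a', b'⟩, hab'⟩ (⟨h1, h2, h3⟩ | ⟨h1, h2, h3⟩)
    · simp only at h1 h2 h3 ⊢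
      subst h3
      simpa [h1] using he₁ _ _ (g.edge_of_step _ _ h2)
    · simp only at h1 h2 h3 ⊢
      subst h3
      have := he₂ _ _ (h.edge_of_step _ _ h2)
      by_cases hb : h.pos b = v <;> by_cases hb' : h.pos b' = v <;> simp_all
  own := by
    rintro ⟨⟨a, b⟩, hab⟩ hs
    simp only at hs hab
    by_cases hb : h.pos b = v
    · rw [if_pos hb] at hs
      obtain ⟨a', ha'⟩ := g.own a (by rw [ho₁]; exact hs)
      exact ⟨⟨(a', b), Or.inr hb⟩, Or.inl ⟨hb, ha', rfl⟩⟩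
    · rw [if_neg hb] at hs
      obtain ⟨b', hb'⟩ := h.own b (by rw [ho₂]; exact hs)
      have ha := hab.resolve_right hb
      exact ⟨⟨(a, b'), Or.inl ha⟩, Or.inr ⟨ha, hb', rfl⟩⟩
  opp := by
    rintro ⟨⟨a, b⟩, hab⟩ hs u hu
    simp only at hs hab hu ⊢
    have left : h.pos b = v → B₁.edge (g.pos a) u → ∃ t : {s : α × β // g.pos s.1 = v ∨
        h.pos s.2 = v}, ((h.pos b = v ∧ g.step a t.1.1 ∧ t.1.2 = b) ∨
        (g.pos a = v ∧ h.step b t.1.2 ∧ t.1.1 = a)) ∧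
        (open Classical in if h.pos t.1.2 = v then g.pos t.1.1 else h.pos t.1.2) = u := by
      intro hb he
      rw [if_pos hb] at hs
      obtain ⟨a', ha', hu'⟩ := g.opp a (by rw [ho₁]; exact hs) u he
      exact ⟨⟨(a', b), Or.inr hb⟩, Or.inl ⟨hb, ha', rfl⟩, by simp [hb, hu']⟩
    have right : g.pos a = v → B₂.edge (h.pos b) u → A.owner (h.pos b) ≠ q →
        ∃ t : {s : α × β // g.pos s.1 = v ∨
        h.pos s.2 = v}, ((h.pos b = v ∧ g.step a t.1.1 ∧ t.1.2 = b) ∨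
        (g.pos a = v ∧ h.step b t.1.2 ∧ t.1.1 = a)) ∧
        (open Classical in if h.pos t.1.2 = v then g.pos t.1.1 else h.pos t.1.2) = u := by
      intro ha he hq
      obtain ⟨b', hb', hu'⟩ := h.opp b (by rw [ho₂]; exact hq) u he
      refine ⟨⟨(a, b'), Or.inl ha⟩, Or.inr ⟨ha, hb', rfl⟩, ?_⟩
      by_cases hv' : h.pos b' = v
      · rw [if_pos hv', ha, ← hv', hu']
      · rw [if_neg hv', hu']
    by_cases hb : h.pos b = v
    · rw [if_pos hb] at hu hs
      by_cases ha : g.pos a = v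
      · rw [ha] at hu
        rcases hvw u hu with h1 | h2
        · exact left hb (by rwa [ha])
        · exact right ha (by rwa [hb]) (by rw [hb, hv]; exact hpq)
      · exact left hb (hn₁ _ _ ha hu)
    · rw [if_neg hb] at hu hs
      exact right (hab.resolve_right hb) (hn₂ _ _ hb hu) hs

/-- The shuffle of strategy graphs that win a Streett condition wins it. -/
theorem StratGraph.shuffle_wins {V : Type u} {A B₁ B₂ : Arena V} {p q : Player} (hpq : p ≠ q)
    {v : V} (hv : A.owner v = p) (ho₁ : B₁.owner = A.owner) (ho₂ : B₂.owner = A.owner)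
    (he₁ : ∀ u w, B₁.edge u w → A.edge u w) (he₂ : ∀ u w, B₂.edge u w → A.edge u w)
    (hn₁ : ∀ u w, u ≠ v → A.edge u w → B₁.edge u w)
    (hn₂ : ∀ u w, u ≠ v → A.edge u w → B₂.edge u w)
    (hvw : ∀ w, A.edge v w → B₁.edge v w ∨ B₂.edge v w)
    {α : Type w} {β : Type w'} {g : StratGraph B₁ q α} {h : StratGraph B₂ q β}
    {ι : Type*} {Req Resp : ι → V → V → Prop} (hg : g.Wins (streettSeq Req Resp))
    (hh : h.Wins (streettSeq Req Resp)) :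
    (g.shuffle hpq hv ho₁ ho₂ he₁ he₂ hn₁ hn₂ hvw h).Wins (streettSeq Req Resp) := by
  intro x hx i hi
  set s := g.shuffle hpq hv ho₁ ho₂ he₁ he₂ hn₁ hn₂ hvw h with hs
  have pos1 : ∀ t, h.pos t.1.2 = v → s.pos t = g.pos t.1.1 := by
    intro t ht
    simp [hs, StratGraph.shuffle, ht]
  have pos2 : ∀ t, g.pos t.1.1 = v → s.pos t = h.pos t.1.2 := by
    intro t ht
    by_cases h' : h.pos t.1.2 = v <;> simp [hs, StratGraph.shuffle, h', ht]
  let T₁ : ℕ → Prop := fun n => h.pos (x n).1.2 = v ∧ g.step (x n).1.1 (x (n + 1)).1.1 ∧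
    (x (n + 1)).1.2 = (x n).1.2
  let T₂ : ℕ → Prop := fun n => g.pos (x n).1.1 = v ∧ h.step (x n).1.2 (x (n + 1)).1.2 ∧
    (x (n + 1)).1.1 = (x n).1.1
  have hT : ∀ n, T₁ n ∨ T₂ n := hx
  have hi' : ∃ᶠ n in atTop, (T₁ n ∧ Req i (s.pos (x n)) (s.pos (x (n + 1)))) ∨
      (T₂ n ∧ Req i (s.pos (x n)) (s.pos (x (n + 1)))) :=
    hi.mono fun n hn => (hT n).imp (fun h => ⟨h, hn⟩) (fun h => ⟨h, hn⟩)
  -- A request made infinitely often is made infinitely often during the moves of one component.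
  -- That component then traces an infinite path of its own graph, whose responses reappear in the
  -- shuffle.
  rcases Filter.frequently_or_distrib.1 hi' with h1 | h2
  · obtain ⟨hinf, hreq⟩ := frequently_comp_nth h1
    have hst : ∀ k, (x (Nat.nth T₁ (k + 1))).1.1 = (x (Nat.nth T₁ k + 1)).1.1 :=
      stutter_nth hinf (z := fun n => (x n).1.1) (fun n hn => ((hT n).resolve_left hn).2.2)
    have hmem : ∀ k, T₁ (Nat.nth T₁ k) := Nat.nth_mem_of_infinite hinf
    have e1 : ∀ k, s.pos (x (Nat.nth T₁ k)) = g.pos (x (Nat.nth T₁ k)).1.1 :=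
      fun k => pos1 _ (hmem k).1
    have e2 : ∀ k, s.pos (x (Nat.nth T₁ k + 1)) = g.pos (x (Nat.nth T₁ (k + 1))).1.1 := by
      intro k
      rw [pos1 _ (by rw [(hmem k).2.2]; exact (hmem k).1), hst]
    have hp := hg (fun k => (x (Nat.nth T₁ k)).1.1) (fun k => by
      simp only
      rw [hst]; exact (hmem k).2.1) i (by simpa only [e1, e2] using hreq)
    refine frequently_of_comp_nth hinf ?_
    simpa only [e1, e2] using hp
  · obtain ⟨hinf, hreq⟩ := frequently_comp_nth h2
    have hst : ∀ k, (x (Nat.nth T₂ (k + 1))).1.2 = (x (Nat.nth T₂ k + 1)).1.2 :=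
      stutter_nth hinf (z := fun n => (x n).1.2) (fun n hn => ((hT n).resolve_right hn).2.2)
    have hmem : ∀ k, T₂ (Nat.nth T₂ k) := Nat.nth_mem_of_infinite hinf
    have e1 : ∀ k, s.pos (x (Nat.nth T₂ k)) = h.pos (x (Nat.nth T₂ k)).1.2 :=
      fun k => pos2 _ (hmem k).1
    have e2 : ∀ k, s.pos (x (Nat.nth T₂ k + 1)) = h.pos (x (Nat.nth T₂ (k + 1))).1.2 := by
      intro k
      rw [pos2 _ (by rw [(hmem k).2.2]; exact (hmem k).1), hst]
    have hp := hh (fun k => (x (Nat.nth T₂ k)).1.2) (fun k => by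
      simp only
      rw [hst]; exact (hmem k).2.1) i (by simpa only [e1, e2] using hreq)
    refine frequently_of_comp_nth hinf ?_
    simpa only [e1, e2] using hp

/-- Transfer of a strategy graph between arenas that agree on the visited vertices. -/
def StratGraph.transfer {V : Type u} {A B : Arena V} {q : Player} {α : Type w}
    (g : StratGraph B q α) (ho : B.owner = A.owner)
    (he : ∀ a w, B.edge (g.pos a) w ↔ A.edge (g.pos a) w) : StratGraph A q α where
  pos := g.pos
  step := g.step
  edge_of_step a b h := (he a _).1 (g.edge_of_step a b h)
  own a h := g.own a (by rw [ho]; exact h)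
  opp a h u hu := g.opp a (by rw [ho]; exact h) u ((he a u).2 hu)

/-- The opponent of a player with a Streett condition wins positionally: on a finite arena there
is a set `W` from which Player `p` violates the Streett condition with a positional strategy,
whereas Player `q` satisfies it from all vertices outside `W`. -/
theorem exists_posWin_compl_streettSeq {V : Type u} [Finite V] {p q : Player} (hpq : p ≠ q)
    {ι : Type*} (Req Resp : ι → V → V → Prop) (A : Arena V) :
    ∃ f W, PosWin A p f W (streettSeq Req Resp)ᶜ ∧ ∀ v ∉ W, ∃ (α : Type u)
      (g : StratGraph A q α) (a : α), g.pos a = v ∧ g.Wins (streettSeq Req Resp) := by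
  induction hN : {e : V × V | A.owner e.1 = p ∧ A.edge e.1 e.2}.ncard using Nat.strong_induction_on
    generalizing A with
  | _ N ih =>
  subst hN
  by_cases hch : ∃ v, A.owner v = p ∧ ∃ u₁ u₂, A.edge v u₁ ∧ A.edge v u₂ ∧ u₁ ≠ u₂
  · obtain ⟨v, hv, u₁, u₂, hu₁, hu₂, hne⟩ := hch
    -- `B₁` deletes the edge from `v` to `u₁`; `B₂` keeps it as the only edge leaving `v`.
    let B₁ : Arena V := ⟨A.owner, fun a b => A.edge a b ∧ ¬ (a = v ∧ b = u₁), fun a => by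
      by_cases h : a = v
      · exact ⟨u₂, h ▸ hu₂, fun h' => hne h'.2.symm⟩
      · obtain ⟨b, hb⟩ := A.exists_edge a
        exact ⟨b, hb, fun h' => h h'.1⟩⟩
    let B₂ : Arena V := ⟨A.owner, fun a b => A.edge a b ∧ (a = v → b = u₁), fun a => by
      by_cases h : a = v
      · exact ⟨u₁, h ▸ hu₁, fun _ => rfl⟩
      · obtain ⟨b, hb⟩ := A.exists_edge a
        exact ⟨b, hb, fun h' => absurd h' h⟩⟩
    have hlt₁ : {e : V × V | B₁.owner e.1 = p ∧ B₁.edge e.1 e.2}.ncard <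
        {e : V × V | A.owner e.1 = p ∧ A.edge e.1 e.2}.ncard := by
      refine Set.ncard_lt_ncard ⟨fun e he => ⟨he.1, he.2.1⟩, fun hsub => ?_⟩ (Set.toFinite _)
      exact (hsub (show (v, u₁) ∈ _ from ⟨hv, hu₁⟩)).2.2 ⟨rfl, rfl⟩
    have hlt₂ : {e : V × V | B₂.owner e.1 = p ∧ B₂.edge e.1 e.2}.ncard <
        {e : V × V | A.owner e.1 = p ∧ A.edge e.1 e.2}.ncard := by
      refine Set.ncard_lt_ncard ⟨fun e he => ⟨he.1, he.2.1⟩, fun hsub => ?_⟩ (Set.toFinite _)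
      exact hne ((hsub (show (v, u₂) ∈ _ from ⟨hv, hu₂⟩)).2.2 rfl).symm
    obtain ⟨f₁, W₁, hW₁, hg₁⟩ := ih _ hlt₁ B₁ rfl
    obtain ⟨f₂, W₂, hW₂, hg₂⟩ := ih _ hlt₂ B₂ rfl
    have hn₁ : ∀ a b, a ≠ v → (B₁.edge a b ↔ A.edge a b) := fun a b h =>
      ⟨fun h' => h'.1, fun h' => ⟨h', fun h'' => h h''.1⟩⟩
    have hn₂ : ∀ a b, a ≠ v → (B₂.edge a b ↔ A.edge a b) := fun a b h =>
      ⟨fun h' => h'.1, fun h' => ⟨h', fun h'' => absurd h'' h⟩⟩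
    have lift : ∀ (B : Arena V) (f : V → V) (W : Set V), B.owner = A.owner →
        (∀ a b, B.edge a b → A.edge a b) → (∀ a b, a ≠ v → A.edge a b → B.edge a b) →
        PosWin B p f W (streettSeq Req Resp)ᶜ → PosWin A p f W (streettSeq Req Resp)ᶜ := by
      intro B f W ho he hn h
      refine ⟨fun a ha hp => ?_, fun a ha hp b hb => ?_, fun ρ hρW hρ hf => ?_⟩
      · have := h.own a ha (by rw [ho]; exact hp)
        exact ⟨he _ _ this.1, this.2⟩
      · exact h.opp a ha (by rw [ho]; exact hp) b (hn a b (fun h' => hp (h' ▸ hv)) hb)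
      · refine h.win ρ hρW (fun n => ?_) (by rw [ho]; exact hf)
        by_cases hp : A.owner (ρ n) = p
        · rw [hf n hp]
          exact (h.own _ (hρW n) (by rw [ho]; exact hp)).1
        · exact hn _ _ (fun h' => hp (h' ▸ hv)) (hρ n)
    have avoid : ∀ (B : Arena V) (f : V → V) (W : Set V), B.owner = A.owner →
        (∀ a b, a ≠ v → (B.edge a b ↔ A.edge a b)) →
        PosWin B p f W (streettSeq Req Resp)ᶜ → v ∈ W → ∀ (α : Type u) (g : StratGraph B q α),
        g.Wins (streettSeq Req Resp) → ∀ a : α, ∃ (α : Type u)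
      (g' : StratGraph A q α) (a' : α), g'.pos a' = g.pos a ∧ g'.Wins (streettSeq Req Resp) := by
      intro B f W ho he h hvW α g hg a
      refine ⟨α, g.transfer ho (fun b w => he _ _ ?_), a, rfl, hg⟩
      intro h'
      exact h.pos_notMem hpq hg b (h' ▸ hvW)
    -- If `v` lies in the set of Player `p`, a winning graph of Player `q` never visits `v`, so it
    -- cannot tell the subarena from `A`.
    by_cases hv₂ : v ∈ W₂
    · refine ⟨f₂, W₂, lift B₂ f₂ W₂ rfl (fun a b h => h.1) (fun a b h => (hn₂ a b h).2) hW₂,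
        fun w hw => ?_⟩
      obtain ⟨α, g, a, rfl, hg⟩ := hg₂ w hw
      exact avoid B₂ f₂ W₂ rfl hn₂ hW₂ hv₂ α g hg a
    refine ⟨f₁, W₁, lift B₁ f₁ W₁ rfl (fun a b h => h.1) (fun a b h => (hn₁ a b h).2) hW₁,
        fun w hw => ?_⟩
    obtain ⟨α, g, a, rfl, hg⟩ := hg₁ w hw
    by_cases hv₁ : v ∈ W₁
    · exact avoid B₁ f₁ W₁ rfl hn₁ hW₁ hv₁ α g hg a
    -- Now `v` is outside both sets. Player `q` resumes `h` when `u₁` is chosen at `v` and `g`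
    -- otherwise; initially `h` is parked at `v`.
    obtain ⟨β, h, b, hb, hh⟩ := hg₂ v hv₂
    have hvw : ∀ w, A.edge v w → B₁.edge v w ∨ B₂.edge v w := by
      intro w hw
      by_cases h : w = u₁
      · exact Or.inr ⟨hw, fun _ => h⟩
      · exact Or.inl ⟨hw, fun h' => h h'.2⟩
    have he₁ : ∀ a b, B₁.edge a b → A.edge a b := fun a b h => h.1
    have he₂ : ∀ a b, B₂.edge a b → A.edge a b := fun a b h => h.1
    have hm₁ : ∀ a b, a ≠ v → A.edge a b → B₁.edge a b := fun a b h => (hn₁ a b h).2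
    have hm₂ : ∀ a b, a ≠ v → A.edge a b → B₂.edge a b := fun a b h => (hn₂ a b h).2
    have ho₁ : B₁.owner = A.owner := rfl
    have ho₂ : B₂.owner = A.owner := rfl
    refine ⟨_, g.shuffle hpq hv ho₁ ho₂ he₁ he₂ hm₁ hm₂ hvw h, ⟨(a, b), Or.inr hb⟩, ?_,
      StratGraph.shuffle_wins hpq hv ho₁ ho₂ he₁ he₂ hm₁ hm₂ hvw hg hh⟩
    simp [StratGraph.shuffle, hb]
  · push Not at hch
    -- Here Player `p` has no choices at all, so a vertex belongs to Player `q` as soon as a single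
    -- play from it satisfies the condition.
    choose f hf using A.exists_edge
    refine ⟨f, {v | ∀ ρ, A.IsPlay ρ → ρ 0 = v → ρ ∉ streettSeq Req Resp}, ⟨?_, ?_, ?_⟩, ?_⟩
    · refine fun v hv _ => ⟨hf v, fun ρ hρ h0 hS => ?_⟩
      refine hv (fun n => Nat.casesOn n v ρ) (fun n => ?_) rfl ((mem_streettSeq_add_iff 1).1 hS)
      cases n with
      | zero => simpa [h0] using hf v
      | succ n => exact hρ n
    · refine fun v hv _ u hu ρ hρ h0 hS => ?_
      refine hv (fun n => Nat.casesOn n v ρ) (fun n => ?_) rfl ((mem_streettSeq_add_iff 1).1 hS)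
      cases n with
      | zero => simpa [h0] using hu
      | succ n => exact hρ n
    · exact fun ρ hW hρ _ => hW 0 ρ hρ rfl
    · intro v hv
      simp only [Set.mem_ofPred_eq, not_forall, not_not] at hv
      obtain ⟨ρ, hρ, h0, hS⟩ := hv
      -- The strategy graph is that one play, with time steps as states; `ULift` only adjusts the
      -- universe.
      refine ⟨ULift ℕ, ⟨fun n => ρ n.down, fun m n => n.down = m.down + 1, ?_, ?_, ?_⟩, ⟨0⟩, h0,
        ?_⟩
      · rintro ⟨m⟩ ⟨n⟩ rfl
        exact hρ m
      · exact fun m _ => ⟨⟨m.down + 1⟩, rfl⟩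
      · refine fun m hm u hu => ⟨⟨m.down + 1⟩, rfl, ?_⟩
        exact hch (ρ m.down) (Player.eq_of_ne hpq.symm hm) _ _ (hρ _) hu
      · intro x hx
        have hxn : ∀ n, (x n).down = n + (x 0).down := by
          intro n
          induction n with
          | zero => simp
          | succ n ih => rw [show (x (n + 1)).down = (x n).down + 1 from hx n, ih]; omega
        have : (fun n => ρ (x n).down) = fun n => ρ (n + (x 0).down) := by
          funext n
          rw [hxn n]
        change (fun n => ρ (x n).down) ∈ _
        rw [this]
        exact (mem_streettSeq_add_iff (x 0).down).2 hS

/-! ### Product arenas and finite-memory strategies. -/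

/-- The product of an arena with a memory update function. -/
def Arena.prod {V : Type u} {M : Type w} (A : Arena V) (upd : M → V → M) : Arena (V × M) where
  owner s := A.owner s.1
  edge s t := A.edge s.1 t.1 ∧ t.2 = upd s.2 t.1
  exists_edge s := by
    obtain ⟨v, hv⟩ := A.exists_edge s.1
    exact ⟨(v, upd s.2 v), hv, rfl⟩

/-- A strategy graph for a product arena yields one for the arena itself. -/
def StratGraph.proj {V : Type u} {M : Type w} {A : Arena V} {upd : M → V → M} {p : Player}
    {α : Type w'} (g : StratGraph (A.prod upd) p α) : StratGraph A p α where
  pos a := (g.pos a).1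
  step := g.step
  edge_of_step a b h := (g.edge_of_step a b h).1
  own a h := g.own a h
  opp a h v hv := by
    obtain ⟨b, hb, hb'⟩ := g.opp a h (v, upd (g.pos a).2 v) ⟨hv, rfl⟩
    exact ⟨b, hb, by rw [hb']⟩

/-- The strategy graph of a strategy, whose states are the histories. -/
def Strategy.graph {V : Type u} {A : Arena V} {p : Player} (σ : Strategy A p) :
    StratGraph A p (List V × V) where
  pos s := s.2
  step s t := A.edge s.2 t.2 ∧ t.1 = s.1 ++ [s.2] ∧ (A.owner s.2 = p → t.2 = σ.move s.1 s.2)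
  edge_of_step _ _ h := h.1
  own s hs := ⟨(s.1 ++ [s.2], σ.move s.1 s.2), σ.legal _ _ hs, rfl, fun _ => rfl⟩
  opp s hs v hv := ⟨(s.1 ++ [s.2], v), ⟨hv, rfl, fun h => absurd h hs⟩, rfl⟩

theorem Strategy.graph_path {V : Type u} {A : Arena V} {p : Player} (σ : Strategy A p)
    {x : ℕ → List V × V} (hx : σ.graph.IsPath x) (h0 : (x 0).1 = []) :
    A.IsPlay (fun n => (x n).2) ∧ σ.Consistent (fun n => (x n).2) := by
  have h1 : ∀ n, (x n).1 = (List.range n).map (fun n => (x n).2) := by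
    intro n
    induction n with
    | zero => simpa using h0
    | succ n ih => rw [(hx n).2.1, ih, List.range_succ]; simp
  refine ⟨fun n => (hx n).1, fun n hn => ?_⟩
  rw [← h1]
  exact (hx n).2.2 hn

theorem Game.IsWinningFrom.mem_winningRegion {V : Type u} {G : Game V} {p : Player}
    {σ : Strategy G.arena p} {W : Set V} (h : G.IsWinningFrom σ W) {v : V} (hv : v ∈ W) :
    v ∈ G.winningRegion p :=
  ⟨σ, fun ρ hρ h0 hc => h ρ hρ (Set.mem_singleton_iff.1 h0 ▸ hv) hc⟩

/-- Opposing strategies from the same vertex have a common play. -/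
theorem Game.disjoint_winningRegion {V : Type u} (G : Game V) (v : V) :
    ¬ (v ∈ G.winningRegion .zero ∧ v ∈ G.winningRegion .one) := by
  rintro ⟨⟨σ, hσ⟩, ⟨τ, hτ⟩⟩
  obtain ⟨x, y, hx0, hy0, hx, hy, hxy⟩ := σ.graph.exists_common_path (by simp) τ.graph
    (a := ([], v)) (b := ([], v)) rfl
  have h1 := σ.graph_path hx (by simp [hx0])
  have h2 := τ.graph_path hy (by simp [hy0])
  have e1 := hσ _ h1.1 (by simp [hx0]) h1.2
  have e2 := hτ _ h2.1 (by simp [hy0]) h2.2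
  have e3 : (fun n => (x n).2) = fun n => (y n).2 := funext hxy
  rw [e3] at e1
  exact e2 e1

/-- With memory update `upd` and next-move function `nxt`, Player `p` stays within the set `G` of
pairs of vertices and memory states, and all resulting sequences are in `Win`. -/
structure MemWin {V : Type u} {M : Type w} (A : Arena V) (p : Player) (upd : M → V → M)
    (nxt : V → M → V) (G : Set (V × M)) (Win : Set (ℕ → V × M)) : Prop where
  own : ∀ v m, (v, m) ∈ G → A.owner v = p →
    A.edge v (nxt v m) ∧ (nxt v m, upd m (nxt v m)) ∈ G
  opp : ∀ v m, (v, m) ∈ G → A.owner v ≠ p → ∀ u, A.edge v u → (u, upd m u) ∈ G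
  win : ∀ z, (∀ n, z n ∈ G) → (A.prod upd).IsPlay z →
    (∀ n, A.owner (z n).1 = p → (z (n + 1)).1 = nxt (z n).1 (z n).2) → z ∈ Win

theorem PosWin.memWin {V : Type u} {M : Type w} {A : Arena V} {p : Player} {upd : M → V → M}
    {f : V × M → V × M} {G : Set (V × M)} {Win : Set (ℕ → V × M)}
    (h : PosWin (A.prod upd) p f G Win) :
    MemWin A p upd (fun v m => (f (v, m)).1) G Win where
  own v m hv hp := by
    obtain ⟨h1, h2⟩ := h.own (v, m) hv hp
    refine ⟨h1.1, ?_⟩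
    rw [← show (f (v, m)).2 = upd m (f (v, m)).1 from h1.2]
    exact h2
  opp v m hv hp u hu := h.opp (v, m) hv hp (u, upd m u) ⟨hu, rfl⟩
  win z hz hplay hf := by
    refine h.win z hz hplay fun n hn => Prod.ext (hf n hn) ?_
    rw [(hplay n).2, (h.own _ (hz n) hn).1.2, hf n hn]

theorem MemWin.mono {V : Type u} {M : Type w} {A : Arena V} {p : Player} {upd : M → V → M}
    {nxt : V → M → V} {G : Set (V × M)} {Win Win' : Set (ℕ → V × M)}
    (h : MemWin A p upd nxt G Win) (hW : ∀ z, (A.prod upd).IsPlay z → z ∈ Win → z ∈ Win') :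
    MemWin A p upd nxt G Win' :=
  ⟨h.own, h.opp, fun z hz hp hf => hW z hp (h.win z hz hp hf)⟩

theorem MemoryStructure.updPlus_append {V M : Type*} (S : MemoryStructure V M) (w : List V)
    (a v : V) : S.updPlus (w ++ [a]) v = S.upd (S.updPlus w a) v := by
  cases w with
  | nil => simp [MemoryStructure.updPlus]
  | cons b w => simp [MemoryStructure.updPlus, List.foldl_append]

/-- A finite-memory winning set is turned into a finite-state strategy. -/
theorem MemWin.exists_nextMove {V : Type u} {M : Type w} {G : Game V} {p : Player}
    {upd : M → V → M} {nxt : V → M → V} {S : Set (V × M)} {Win : Set (ℕ → V × M)}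
    (h : MemWin G.arena p upd nxt S Win) (init : V → M)
    (hW : ∀ z ∈ Win, (G.arena.prod upd).IsPlay z → (z 0).2 = init (z 0).1 →
      G.WonBy p (fun n => (z n).1)) :
    ∃ f : NextMove G.arena p M,
      G.IsWinningFrom ((⟨init, upd⟩ : MemoryStructure V M).strategy f) {v | (v, init v) ∈ S} := by
  classical
  -- A next-move function must be legal everywhere, so an arbitrary edge is used where `nxt` is not
  -- legal, which never happens within `S`.
  refine ⟨⟨fun v m => if G.arena.edge v (nxt v m) then nxt v m else (G.arena.exists_edge v).choose,
    fun v m _ => ?_⟩, ?_⟩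
  · split_ifs with h'
    · exact h'
    · exact (G.arena.exists_edge v).choose_spec
  · intro ρ hρ h0 hc
    set T : MemoryStructure V M := ⟨init, upd⟩ with hT
    let m : ℕ → M := fun n => T.updPlus ((List.range n).map ρ) (ρ n)
    have hm : ∀ n, m (n + 1) = upd (m n) (ρ (n + 1)) := by
      intro n
      simp only [m, List.range_succ, List.map_append, List.map_cons, List.map_nil]
      exact T.updPlus_append _ _ _
    have hn : ∀ n, (ρ n, m n) ∈ S → G.arena.owner (ρ n) = p → ρ (n + 1) = nxt (ρ n) (m n) := by
      intro n hS hp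
      rw [hc n hp]
      exact if_pos (h.own _ _ hS hp).1
    have hS : ∀ n, (ρ n, m n) ∈ S := by
      intro n
      induction n with
      | zero => exact h0
      | succ n ih =>
        rw [hm]
        by_cases hp : G.arena.owner (ρ n) = p
        · rw [hn n ih hp]
          exact (h.own _ _ ih hp).2
        · exact h.opp _ _ ih hp _ (hρ n)
    have hplay : (G.arena.prod upd).IsPlay (fun n => (ρ n, m n)) := fun n => ⟨hρ n, hm n⟩
    exact hW (fun n => (ρ n, m n)) (h.win _ hS hplay (fun n => hn n (hS n))) hplay rfl

/-! ### Index appearance records. -/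

section IndexAppearanceRecord

variable {ι : Type*} {n : ℕ}

open Classical in
/-- The sort key for the update of a ranking: the elements of `H` come first. -/
noncomputable def rankKey (π : ι ≃ Fin n) (H : ι → Prop) (i : ι) : ℕ :=
  if H i then π i else n + π i

theorem rankKey_injective (π : ι ≃ Fin n) (H : ι → Prop) : Function.Injective (rankKey π H) := by
  intro i j hij
  have hi := (π i).isLt
  have hj := (π j).isLt
  unfold rankKey at hij
  apply π.injective
  apply Fin.ext
  split_ifs at hij <;> omega

-- The new rank counts the smaller keys. As keys are distinct, this is an injection between finite
-- sets of equal size.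
open Classical in
theorem exists_rankUpdate (π : ι ≃ Fin n) (H : ι → Prop) :
    ∃ π' : ι ≃ Fin n, ∀ i, (π' i : ℕ) =
      ((Finset.univ : Finset (Fin n)).filter
        (fun k => rankKey π H (π.symm k) < rankKey π H i)).card := by
  have hlt : ∀ i, ((Finset.univ : Finset (Fin n)).filter
        (fun k => rankKey π H (π.symm k) < rankKey π H i)).card < n := by
    intro i
    have : (Finset.univ : Finset (Fin n)).filter
        (fun k => rankKey π H (π.symm k) < rankKey π H i) ⊂ Finset.univ := by
      refine Finset.ssubset_univ_iff.2 fun h => ?_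
      have := h ▸ Finset.mem_univ (π i)
      simp at this
    simpa using Finset.card_lt_card this
  let f : ι → Fin n := fun i => ⟨_, hlt i⟩
  have hmono : ∀ i j, rankKey π H i < rankKey π H j → f i < f j := by
    intro i j hij
    simp only [f, Fin.mk_lt_mk]
    refine Finset.card_lt_card (Finset.ssubset_iff_subset_ne.2 ⟨fun k hk => ?_, fun h => ?_⟩)
    · simp only [Finset.mem_filter, Finset.mem_univ, true_and] at hk ⊢
      omega
    · have : π i ∈ (Finset.univ : Finset (Fin n)).filter
        (fun k => rankKey π H (π.symm k) < rankKey π H j) := by simpa using hij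
      rw [← h] at this
      simp at this
  have hf : Function.Injective f := by
    intro i j hij
    rcases lt_trichotomy (rankKey π H i) (rankKey π H j) with h | h | h
    · exact absurd hij (hmono _ _ h).ne
    · exact rankKey_injective π H h
    · exact absurd hij (hmono _ _ h).ne'
  have : Fintype ι := Fintype.ofEquiv _ π.symm
  have hb : Function.Bijective f :=
    (Fintype.bijective_iff_injective_and_card f).2 ⟨hf, Fintype.card_congr π⟩
  exact ⟨Equiv.ofBijective f hb, fun i => rfl⟩

/-- The update of a ranking: the elements of `H` get the lowest ranks. -/
noncomputable def rankUpdate (π : ι ≃ Fin n) (H : ι → Prop) : ι ≃ Fin n :=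
  (exists_rankUpdate π H).choose

open Classical in
theorem rankUpdate_apply (π : ι ≃ Fin n) (H : ι → Prop) (i : ι) :
    (rankUpdate π H i : ℕ) = ((Finset.univ : Finset (Fin n)).filter
        (fun k => rankKey π H (π.symm k) < rankKey π H i)).card :=
  (exists_rankUpdate π H).choose_spec i

theorem iio_subset_rankKey (π : ι ≃ Fin n) {H : ι → Prop} {i : ι} (hi : ¬ H i) {k : Fin n}
    (hk : k < π i) : rankKey π H (π.symm k) < rankKey π H i := by
  have h1 : (k : ℕ) < π i := hk
  unfold rankKey
  rw [if_neg hi]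
  split_ifs <;> simp <;> omega

/-- Whatever preceded `i` still precedes it, whether or not it is moved to the front. -/
theorem le_rankUpdate (π : ι ≃ Fin n) {H : ι → Prop} {i : ι} (hi : ¬ H i) :
    π i ≤ rankUpdate π H i := by
  classical
  rw [Fin.le_def, rankUpdate_apply, ← Fin.card_Iio (π i)]
  refine Finset.card_le_card fun k hk => ?_
  simpa using iio_subset_rankKey π hi (Finset.mem_Iio.1 hk)

/-- The element `j` overtakes `i`, in addition to all former predecessors of `i`. -/
theorem lt_rankUpdate (π : ι ≃ Fin n) {H : ι → Prop} {i j : ι} (hi : ¬ H i) (hj : H j)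
    (hij : π i < π j) : π i < rankUpdate π H i := by
  classical
  rw [Fin.lt_def, rankUpdate_apply, ← Fin.card_Iio (π i)]
  refine Finset.card_lt_card (Finset.ssubset_iff_subset_ne.2 ⟨fun k hk => ?_, fun h => ?_⟩)
  · simpa using iio_subset_rankKey π hi (Finset.mem_Iio.1 hk)
  · have : π j ∈ Finset.Iio (π i) := by
      rw [h]
      have := (π j).isLt
      simp [rankKey, hi, hj]
      omega
    exact absurd (Finset.mem_Iio.1 this) hij.not_gt

/-- If nothing at or above the rank of `i` moves, its predecessors are merely permuted among
themselves. -/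
theorem rankUpdate_eq (π : ι ≃ Fin n) {H : ι → Prop} {i : ι}
    (h : ∀ j, π i ≤ π j → ¬ H j) : rankUpdate π H i = π i := by
  classical
  have hi := h i le_rfl
  refine le_antisymm ?_ (le_rankUpdate π hi)
  rw [Fin.le_def, rankUpdate_apply]
  conv_rhs => rw [← Fin.card_Iio (π i)]
  refine Finset.card_le_card fun k hk => ?_
  simp only [Finset.mem_filter, Finset.mem_univ, true_and] at hk
  by_contra hk'
  simp only [Finset.mem_Iio, not_lt] at hk'
  have h1 := h (π.symm k) (by simpa using hk')
  have h2 : (π i : ℕ) ≤ k := hk'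
  simp [rankKey, hi, h1] at hk
  omega

theorem frequently_exists_of_finite {κ : Type*} [Finite κ] {P : κ → ℕ → Prop}
    (h : ∃ᶠ m in atTop, ∃ k, P k m) : ∃ k, ∃ᶠ m in atTop, P k m := by
  by_contra hc
  simp only [not_exists, Filter.not_frequently] at hc
  exact h ((Filter.eventually_all.2 hc).mono fun m hm => by simpa using hm)

/-- Correctness of index appearance records: a sequence satisfies the Streett condition if and
only if it violates the condition in terms of ranks. -/
theorem streett_iff_not_rank {req resp : ℕ → ι → Prop} {π : ℕ → (ι ≃ Fin n)}
    (hπ : ∀ m, π (m + 1) = rankUpdate (π m) (resp m)) :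
    (∀ i, (∃ᶠ m in atTop, req m i) → ∃ᶠ m in atTop, resp m i) ↔
      ¬ ∀ k : ℕ, (∃ᶠ m in atTop, k = 0 ∨ ∃ i, resp m i ∧ (π m i : ℕ) + 1 = k) →
        ∃ᶠ m in atTop, ∃ i, req m i ∧ k ≤ π m i := by
  constructor
  · intro hS hT
    have h0 : ∃ᶠ m in atTop, ∃ r : Fin n, ∃ i, req m i ∧ π m i = r := by
      refine (hT 0 (Filter.Frequently.of_forall fun m => Or.inl rfl)).mono ?_
      rintro m ⟨i, hi, -⟩
      exact ⟨_, i, hi, rfl⟩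
    -- The highest rank at which requests occur infinitely often. Eventually no response has rank
    -- `r` or more, so the index at rank `r` is frozen: it is requested forever and never answered.
    obtain ⟨r, hr⟩ : ∃ r, Maximal (fun r : Fin n => ∃ᶠ m in atTop, ∃ i, req m i ∧ π m i = r) r :=
      (Set.toFinite {r : Fin n | ∃ᶠ m in atTop, ∃ i, req m i ∧ π m i = r}).exists_maximal
        (frequently_exists_of_finite h0)
    have hev : ∀ᶠ m in atTop, ∀ j, r ≤ π m j → ¬ resp m j := by
      by_contra hc
      have hc' : ∃ᶠ m in atTop, ∃ a : Fin n, r ≤ a ∧ ∃ j, resp m j ∧ π m j = a := by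
        refine (Filter.not_eventually.1 hc).mono fun m hm => ?_
        push Not at hm
        obtain ⟨j, hj, hj'⟩ := hm
        exact ⟨_, hj, j, hj', rfl⟩
      obtain ⟨a, ha⟩ := frequently_exists_of_finite hc'
      have hra : r ≤ a := ha.exists.choose_spec.1
      have hreq : ∃ᶠ m in atTop, ∃ b : Fin n, a < b ∧ ∃ i, req m i ∧ π m i = b := by
        refine (hT (a + 1) (ha.mono ?_)).mono ?_
        · rintro m ⟨-, j, hj, hj'⟩
          exact Or.inr ⟨j, hj, by rw [hj']⟩
        · rintro m ⟨i, hi, hi'⟩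
          exact ⟨_, Fin.lt_def.2 hi', i, hi, rfl⟩
      obtain ⟨b, hb⟩ := frequently_exists_of_finite hreq
      have hab : a < b := hb.exists.choose_spec.1
      exact absurd (hr.2 (hb.mono fun m hm => hm.2) (hra.trans hab.le)) (hra.trans_lt hab).not_ge
    obtain ⟨N, hN⟩ := Filter.eventually_atTop.1 hev
    have hconst : ∀ m, N ≤ m → π m ((π N).symm r) = r := by
      intro m hm
      induction m, hm using Nat.le_induction with
      | base => simp
      | succ m hm ih => rw [hπ, rankUpdate_eq _ (by rw [ih]; exact hN m hm), ih]
    have hreq : ∃ᶠ m in atTop, req m ((π N).symm r) := by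
      refine (hr.1.and_eventually (Filter.eventually_ge_atTop N)).mono ?_
      rintro m ⟨⟨i, hi, hi'⟩, hm⟩
      rwa [(π m).injective (hi'.trans (hconst m hm).symm)] at hi
    refine hS _ hreq (Filter.eventually_atTop.2 ⟨N, fun m hm => ?_⟩)
    exact hN m hm _ (hconst m hm).ge
  · intro hT
    by_contra hS
    refine hT fun k hk => ?_
    push Not at hS
    obtain ⟨i, hi, hi'⟩ := hS
    obtain ⟨N, hN⟩ := Filter.eventually_atTop.1 hi'
    -- An index that is no longer answered can only rise, so its rank stabilises. From then on every
    -- response has a smaller rank, since a higher one would push the index up.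
    have hmono : Monotone fun m => π (N + m) i :=
      monotone_nat_of_le_succ fun m => by
        rw [← add_assoc, hπ]
        exact le_rankUpdate _ (hN _ (Nat.le_add_right _ _))
    obtain ⟨K, hK⟩ := WellFoundedGT.monotone_chain_condition ⟨_, hmono⟩
    have hconst : ∀ m, N + K ≤ m → π m i = π (N + K) i := by
      intro m hm
      have := hK (m - N) (by omega)
      simp only [OrderHom.coe_mk] at this
      rw [this]
      congr 2
      omega
    have hresp : ∀ m, N + K ≤ m → ∀ j, resp m j → π m j < π (N + K) i := by
      intro m hm j hj
      by_contra hlt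
      rw [not_lt, ← hconst m hm] at hlt
      have hmi : ¬ resp m i := hN m (by omega)
      rcases hlt.lt_or_eq with h | h
      · have h1 := lt_rankUpdate (π m) hmi hj h
        rw [← hπ, hconst m hm, hconst (m + 1) (by omega)] at h1
        exact lt_irrefl _ h1
      · exact hmi ((π m).injective h ▸ hj)
    have hkr : k ≤ π (N + K) i := by
      obtain ⟨m, hm, hm'⟩ := Filter.frequently_atTop.1 hk (N + K)
      rcases hm' with h | ⟨j, hj, hj'⟩
      · omega
      · have := Fin.lt_def.1 (hresp m hm j hj)
        omega
    refine (hi.and_eventually (Filter.eventually_ge_atTop (N + K))).mono ?_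
    rintro m ⟨h1, h2⟩
    exact ⟨i, h1, by rwa [hconst m h2]⟩

end IndexAppearanceRecord

/-! ### Open requests and the relaxed Streett condition. -/

section Tracking

variable {V : Type u} {d : ℕ}

open Classical in
/-- The requests that are open after the one-letter word `v`. -/
noncomputable def openInit (Γ : StreettPairs V d) (v : V) : Finset (Fin d) :=
  Finset.univ.filter fun c => v ∈ Γ.Q c ∧ v ∉ Γ.P c

open Classical in
/-- The update of the set of open requests. -/
noncomputable def openUpd (Γ : StreettPairs V d) (R : Finset (Fin d)) (v : V) : Finset (Fin d) :=
  Finset.univ.filter fun c => (c ∈ R ∨ v ∈ Γ.Q c) ∧ v ∉ Γ.P c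

/-- The sets of open requests along a sequence. -/
noncomputable def openSeq (Γ : StreettPairs V d) (ρ : ℕ → V) : ℕ → Finset (Fin d)
  | 0 => openInit Γ (ρ 0)
  | n + 1 => openUpd Γ (openSeq Γ ρ n) (ρ (n + 1))

theorem mem_openUpd {Γ : StreettPairs V d} {R : Finset (Fin d)} {v : V} {c : Fin d} :
    c ∈ openUpd Γ R v ↔ (c ∈ R ∨ v ∈ Γ.Q c) ∧ v ∉ Γ.P c := by
  simp [openUpd]

theorem eq_openSeq {Γ : StreettPairs V d} {ρ : ℕ → V} {R : ℕ → Finset (Fin d)}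
    (h0 : R 0 = openInit Γ (ρ 0)) (h : ∀ n, R (n + 1) = openUpd Γ (R n) (ρ (n + 1))) :
    R = openSeq Γ ρ := by
  funext n
  induction n with
  | zero => exact h0
  | succ n ih => rw [h, ih, openSeq]

/-- Streett requests on vertices with sets of open requests: increment-edges and requests. -/
def trackReq (Γ : StreettPairs V d) (cst : Fin d → CostFunction V) :
    Fin d ⊕ Fin d → V × Finset (Fin d) → V × Finset (Fin d) → Prop
  | .inl c, s, t => cst c s.1 t.1 = Label.inc
  | .inr c, _, t => t.1 ∈ Γ.Q c

/-- Streett responses on vertices with sets of open requests: the request is not open, or it is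
answered. -/
def trackResp (Γ : StreettPairs V d) : Fin d ⊕ Fin d → V × Finset (Fin d) → Prop
  | .inl c, t => c ∉ t.2
  | .inr c, t => t.1 ∈ Γ.P c

/-- The Streett condition that relaxes the bounded cost-Streett condition. -/
def relaxedStreett (Γ : StreettPairs V d) (cst : Fin d → CostFunction V) :
    Set (ℕ → V × Finset (Fin d)) :=
  streettSeq (trackReq Γ cst) fun i _ t => trackResp Γ i t

theorem stCorPair_eq_top {Γ : StreettPairs V d} {cst : Fin d → CostFunction V} {ρ : ℕ → V} {c : Fin d}
    {k : ℕ} (hk : ρ k ∈ Γ.Q c) (h : ∀ j, k ≤ j → ρ j ∉ Γ.P c) : stCorPair Γ cst ρ c k = ⊤ := by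
  rw [stCorPair, if_pos hk]
  simp only [iInf_eq_top]
  exact fun j hj => absurd hj.2 (h j hj.1)

theorem stCorPair_le {Γ : StreettPairs V d} {cst : Fin d → CostFunction V} {ρ : ℕ → V} {c : Fin d}
    {k k' : ℕ} (hk : k ≤ k') (h : ρ k' ∈ Γ.P c) :
    stCorPair Γ cst ρ c k ≤ infixCost (cst c) ρ k k' := by
  rw [stCorPair]
  split_ifs
  · exact iInf₂_le k' ⟨hk, h⟩
  · exact bot_le

theorem exists_request_of_mem_openSeq {Γ : StreettPairs V d} {ρ : ℕ → V} {c : Fin d} {n : ℕ}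
    (h : c ∈ openSeq Γ ρ n) :
    ∃ k ≤ n, ρ k ∈ Γ.Q c ∧ ∀ j, k ≤ j → j ≤ n → ρ j ∉ Γ.P c := by
  induction n with
  | zero =>
    simp only [openSeq, openInit, Finset.mem_filter, Finset.mem_univ, true_and] at h
    exact ⟨0, le_rfl, h.1, fun j _ hj => by rw [Nat.le_zero.1 hj]; exact h.2⟩
  | succ n ih =>
    rw [openSeq, mem_openUpd] at h
    rcases h with ⟨h | h, h'⟩
    · obtain ⟨k, hk, hQ, hP⟩ := ih h
      refine ⟨k, by omega, hQ, fun j hkj hj => ?_⟩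
      rcases Nat.lt_or_ge n j with hj' | hj'
      · rwa [show j = n + 1 by omega]
      · exact hP j hkj hj'
    · exact ⟨n + 1, le_rfl, h, fun j hj hj' => by rwa [show j = n + 1 by omega]⟩

theorem limsup_lt_top_iff {f : ℕ → ℕ∞} :
    Filter.limsup f atTop < ⊤ ↔ ∃ b : ℕ, ∀ᶠ k in atTop, f k ≤ b := by
  constructor
  · intro h
    lift Filter.limsup f atTop to ℕ using h.ne with b hb
    refine ⟨b, ?_⟩
    have h2 : Filter.limsup f atTop < (b + 1 : ℕ) := by
      rw [← hb]
      exact_mod_cast Nat.lt_succ_self b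
    refine (Filter.eventually_lt_of_limsup_lt h2).mono fun k hk => ?_
    push_cast at hk
    exact Order.le_of_lt_add_one hk
  · rintro ⟨b, hb⟩
    exact (Filter.limsup_le_of_le (h := hb)).trans_lt (ENat.natCast_lt_top b)

/-- Sequences in the bounded cost-Streett condition satisfy the relaxed Streett condition. -/
theorem mem_relaxedStreett_of_mem_bndCostStreett {Γ : StreettPairs V d}
    {cst : Fin d → CostFunction V} {ρ : ℕ → V} (h : ρ ∈ bndCostStreett Γ cst) :
    (fun n => (ρ n, openSeq Γ ρ n)) ∈ relaxedStreett Γ cst := by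
  obtain ⟨hlim, hun⟩ := h
  rintro (c | c) hc
  · simp only [trackReq, trackResp] at hc ⊢
    intro hev
    obtain ⟨N, hN⟩ := Filter.eventually_atTop.1 hev
    simp only [not_not] at hN
    obtain ⟨k, hk, hQ, hP⟩ := exists_request_of_mem_openSeq (hN N le_rfl)
    refine hun k ⟨c, hQ, stCorPair_eq_top hQ fun j hj => ?_, ?_⟩
    · rcases Nat.lt_or_ge (N + 1) j with hj' | hj'
      · have := hN (j - 1) (by omega)
        rw [show j - 1 + 1 = j by omega, show j = (j - 1) + 1 by omega, openSeq,
          mem_openUpd] at this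
        rw [show j = (j - 1) + 1 by omega]
        exact this.2
      · exact hP j hj hj'
    · exact Nat.frequently_atTop_iff_infinite.1
        ((hc.and_eventually (Filter.eventually_ge_atTop k)).mono fun n hn => ⟨hn.2, hn.1⟩)
  · simp only [trackReq, trackResp] at hc ⊢
    obtain ⟨b, hb⟩ := limsup_lt_top_iff.1 hlim
    rw [frequently_add_iff (fun n => ρ n ∈ Γ.Q c)] at hc
    rw [frequently_add_iff (fun n => ρ n ∈ Γ.P c)]
    refine Filter.frequently_atTop.2 fun N => ?_
    obtain ⟨k, hk, hQ, hkb⟩ := Filter.frequently_atTop.1 (hc.and_eventually hb) N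
    by_contra hno
    push Not at hno
    have h1 : stCorPair Γ cst ρ c k = ⊤ :=
      stCorPair_eq_top hQ fun j hj => hno j (hk.trans hj)
    have h2 : stCorPair Γ cst ρ c k ≤ b :=
      (le_iSup (fun c => stCorPair Γ cst ρ c k) c).trans hkb
    rw [h1] at h2
    exact absurd h2 (by simp)

theorem infixCost_eq_card (cst : CostFunction V) (ρ : ℕ → V) (k k' : ℕ) [DecidableEq Label] :
    infixCost cst ρ k k' =
      ((Finset.Ico k k').filter fun j => cst (ρ j) (ρ (j + 1)) = Label.inc).card := by
  rw [infixCost, Finset.card_filter]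
  refine Finset.sum_congr rfl fun j _ => ?_
  cases cst (ρ j) (ρ (j + 1)) <;> simp [Label.weight]

/-- A finite-memory strategy for the relaxed Streett condition bounds the costs while a request is
open, since otherwise a loop could be repeated. -/
theorem MemWin.infixCost_le [Finite V] {M : Type w} [Finite M] {A : Arena V} {p : Player}
    {Γ : StreettPairs V d} {cst : Fin d → CostFunction V}
    {upd : Finset (Fin d) × M → V → Finset (Fin d) × M} {nxt : V → Finset (Fin d) × M → V}
    {G : Set (V × Finset (Fin d) × M)}
    (h : MemWin A p upd nxt G {z | (fun n => ((z n).1, (z n).2.1)) ∈ relaxedStreett Γ cst})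
    {z : ℕ → V × Finset (Fin d) × M} (hz : ∀ n, z n ∈ G) (hp : (A.prod upd).IsPlay z)
    (hf : ∀ n, A.owner (z n).1 = p → (z (n + 1)).1 = nxt (z n).1 (z n).2) {c : Fin d} {k k' : ℕ}
    (hk : ∀ j, k ≤ j → j < k' → c ∈ (z j).2.1) :
    infixCost (cst c) (fun n => (z n).1) k k' ≤ Nat.card (V × Finset (Fin d) × M) := by
  classical
  by_contra hlt
  rw [not_le, infixCost_eq_card] at hlt
  have : Fintype (V × Finset (Fin d) × M) := Fintype.ofFinite _
  rw [Nat.card_eq_fintype_card, ← Finset.card_univ] at hlt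
  -- Two positions just before a `c`-increment carry the same state; the segment between them is
  -- repeated forever.
  obtain ⟨i, hi, j, hj, hij, hzij⟩ :=
    Finset.exists_ne_map_eq_of_card_lt_of_maps_to hlt (f := z) (fun _ _ => Finset.mem_univ _)
  wlog hlt' : i < j generalizing i j
  · exact this j hj i hi hij.symm hzij.symm (by omega)
  simp only [Finset.mem_filter, Finset.mem_Ico] at hi hj
  obtain ⟨q, rfl⟩ : ∃ q, j = i + (q + 1) := ⟨j - i - 1, by omega⟩
  -- Wrapping around is a legal step because `z (i + (q + 1)) = z i`.
  have hsucc : ∀ n, z (i + (n + 1) % (q + 1)) = z (i + n % (q + 1) + 1) := by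
    intro n
    have h1 := Nat.mod_lt n (show q + 1 > 0 by omega)
    rw [Nat.add_mod n 1]
    rcases Nat.lt_or_ge (n % (q + 1) + 1) (q + 1) with h2 | h2
    · rw [Nat.mod_eq_of_lt (a := 1) (by omega), Nat.mod_eq_of_lt h2, add_assoc]
    · have h3 : n % (q + 1) = q := by omega
      rw [h3]
      rcases Nat.eq_zero_or_pos q with rfl | hq
      · simpa using hzij
      · rw [Nat.mod_eq_of_lt (a := 1) (by omega), Nat.mod_self]
        simpa [add_assoc] using hzij
  have hrel := h.win (fun n => z (i + n % (q + 1))) (fun n => hz _)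
    (fun n => by simp only [hsucc]; exact hp _) (fun n => by simp only [hsucc]; exact hf _)
    (.inl c) (by
      simp only [trackReq, hsucc]
      refine Filter.frequently_atTop.2 fun N => ⟨N * (q + 1), by nlinarith, ?_⟩
      simpa using hi.2)
  obtain ⟨n, hn⟩ := hrel.exists
  have h1 := Nat.mod_lt (n + 1) (show q + 1 > 0 by omega)
  exact hn (hk _ (by omega) (by omega))

/-- A request stays in the tracked set until it is answered, so `MemWin.infixCost_le` bounds its
cost. An arbitrary initial tracked set can only spoil the request at position `0`, which matters for
the bounded condition but not for the limit superior. -/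
theorem MemWin.costStreett_of_relaxedStreett [Finite V] {M : Type w} [Finite M] {A : Arena V}
    {p : Player} {Γ : StreettPairs V d} {cst : Fin d → CostFunction V}
    {upd : Finset (Fin d) × M → V → Finset (Fin d) × M} {nxt : V → Finset (Fin d) × M → V}
    {G : Set (V × Finset (Fin d) × M)} (hupd : ∀ m v, (upd m v).1 = openUpd Γ m.1 v)
    (h : MemWin A p upd nxt G {z | (fun n => ((z n).1, (z n).2.1)) ∈ relaxedStreett Γ cst}) :
    MemWin A p upd nxt G {z | (fun n => (z n).1) ∈ costStreett Γ cst ∧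
      ((z 0).2.1 = openInit Γ (z 0).1 → (fun n => (z n).1) ∈ bndCostStreett Γ cst)} := by
  classical
  refine ⟨h.own, h.opp, fun z hz hp hf => ?_⟩
  have hR : ∀ n, (z (n + 1)).2.1 = openUpd Γ (z n).2.1 (z (n + 1)).1 := fun n => by
    rw [(hp n).2, hupd]
  have hrel : (fun n => ((z n).1, (z n).2.1)) ∈ relaxedStreett Γ cst := h.win z hz hp hf
  have hopen : ∀ c k, (0 < k ∨ (z 0).2.1 = openInit Γ (z 0).1) → (z k).1 ∈ Γ.Q c → ∀ k',
      (∀ j, k ≤ j → j < k' → (z j).1 ∉ Γ.P c) → ∀ j, k ≤ j → j < k' → c ∈ (z j).2.1 := by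
    intro c k hk hQ k' hP j hkj hjk
    induction j, hkj using Nat.le_induction with
    | base =>
      have hP' := hP k le_rfl hjk
      cases k with
      | zero =>
        rw [hk.resolve_left (by omega)]
        simp [openInit, hQ, hP']
      | succ k =>
        rw [hR, mem_openUpd]
        exact ⟨Or.inr hQ, hP'⟩
    | succ j hkj ih =>
      rw [hR, mem_openUpd]
      exact ⟨Or.inl (ih (by omega)), hP _ (by omega) hjk⟩
  have hcost : (fun n => (z n).1) ∈ costStreett Γ cst := by
    refine limsup_lt_top_iff.2 ⟨Nat.card (V × Finset (Fin d) × M), ?_⟩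
    simp only [stCor, iSup_le_iff]
    refine Filter.eventually_all.2 fun c => ?_
    by_cases hQ : ∃ᶠ n in atTop, (z n).1 ∈ Γ.Q c
    · have hP := hrel (.inr c) (by
        simpa only [trackReq, frequently_add_iff (fun n => (z n).1 ∈ Γ.Q c)] using hQ)
      simp only [trackResp, frequently_add_iff (fun n => (z n).1 ∈ Γ.P c)] at hP
      filter_upwards [Filter.eventually_gt_atTop 0] with k hk
      by_cases hkQ : (z k).1 ∈ Γ.Q c
      · have hex : ∃ j, k ≤ j ∧ (z j).1 ∈ Γ.P c := by
          obtain ⟨j, hj, hj'⟩ := Filter.frequently_atTop.1 hP k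
          exact ⟨j, hj, hj'⟩
        have hspec := Nat.find_spec hex
        refine (stCorPair_le (ρ := fun n => (z n).1) hspec.1 hspec.2).trans ?_
        exact_mod_cast h.infixCost_le hz hp hf (hopen c k (Or.inl hk) hkQ _ fun j hkj hj hjP =>
          Nat.find_min hex hj ⟨hkj, hjP⟩)
      · simp [stCorPair, hkQ]
    · filter_upwards [Filter.not_frequently.1 hQ] with k hk
      simp [stCorPair, hk]
  refine ⟨hcost, fun h0 => ⟨hcost, ?_⟩⟩
  rintro k ⟨c, hQ, htop, hinf⟩
  have hno : ∀ j, k ≤ j → (z j).1 ∉ Γ.P c := by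
    intro j hj hP
    have := stCorPair_le (cst := cst) (ρ := fun n => (z n).1) hj hP
    rw [htop] at this
    exact absurd this (by simp)
  have hc := hrel (.inl c) (by
    refine (Nat.frequently_atTop_iff_infinite.2 hinf).mono fun n hn => hn.2)
  obtain ⟨n, hn, hn'⟩ := Filter.frequently_atTop.1 hc k
  -- The response is evaluated after the edge, at position `n + 1`, and the upper end in `hopen` is
  -- exclusive.
  exact hn' (hopen c k (Or.inr h0) hQ (n + 2) (fun j hj _ => hno j hj) _ (by omega) (by omega))

end Tracking

/-! ### The bounded game. -/

section Solution

variable {V : Type u} {d : ℕ}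

/-- The memory update that tracks open requests and a ranking of the Streett pairs. -/
noncomputable def rankedUpd (Γ : StreettPairs V d) {n : ℕ}
    (m : Finset (Fin d) × (Fin d ⊕ Fin d ≃ Fin n)) (v : V) :
    Finset (Fin d) × (Fin d ⊕ Fin d ≃ Fin n) :=
  (openUpd Γ m.1 v, rankUpdate m.2 fun i => trackResp Γ i (v, openUpd Γ m.1 v))

/-- Player 0 has a finite-memory winning set for the relaxed Streett condition that contains all
vertices from which she can satisfy it. -/
theorem exists_memWin_zero [Finite V] (A : Arena V) (Γ : StreettPairs V d)
    (cst : Fin d → CostFunction V) (n : ℕ) :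
    ∃ nxt G, MemWin A .zero (rankedUpd Γ (n := n)) nxt G
      {z | (fun n => ((z n).1, (z n).2.1)) ∈ relaxedStreett Γ cst} ∧
      ∀ (α : Type u) (g : StratGraph A .zero α) (a : α) (π : Fin d ⊕ Fin d ≃ Fin n),
        (∀ x, x 0 = a → g.IsPath x →
          (fun n => (g.pos (x n), openSeq Γ (fun n => g.pos (x n)) n)) ∈ relaxedStreett Γ cst) →
        (g.pos a, openInit Γ (g.pos a), π) ∈ G := by
  let Req : ℕ → V × Finset (Fin d) × (Fin d ⊕ Fin d ≃ Fin n) →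
      V × Finset (Fin d) × (Fin d ⊕ Fin d ≃ Fin n) → Prop :=
    fun k s t => k = 0 ∨ ∃ i, trackResp Γ i (t.1, t.2.1) ∧ (s.2.2 i : ℕ) + 1 = k
  let Resp : ℕ → V × Finset (Fin d) × (Fin d ⊕ Fin d ≃ Fin n) →
      V × Finset (Fin d) × (Fin d ⊕ Fin d ≃ Fin n) → Prop :=
    fun k s t => ∃ i, trackReq Γ cst i (s.1, s.2.1) (t.1, t.2.1) ∧ k ≤ s.2.2 i
  obtain ⟨f, G, hG, hout⟩ := exists_posWin_compl_streettSeq (p := .zero) (q := .one) (by simp)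
    Req Resp (A.prod (rankedUpd Γ (n := n)))
  have key : ∀ z, (A.prod (rankedUpd Γ (n := n))).IsPlay z →
      ((fun n => ((z n).1, (z n).2.1)) ∈ relaxedStreett Γ cst ↔ z ∉ streettSeq Req Resp) := by
    intro z hz
    have hR : ∀ m, (z (m + 1)).2.2 =
        rankUpdate (z m).2.2 fun i => trackResp Γ i ((z (m + 1)).1, (z (m + 1)).2.1) := by
      intro m
      rw [(hz m).2]
      rfl
    exact streett_iff_not_rank hR
  refine ⟨_, G, hG.memWin.mono fun z hz hzW => (key z hz).2 hzW, fun α g a π hg => ?_⟩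
  by_contra hmem
  -- Outside `G`, Player 1 can enforce the rank condition, which means violating the relaxed one.
  -- Playing this against `g` gives a contradictory play.
  obtain ⟨β, h, b, hb, hh⟩ := hout _ hmem
  obtain ⟨x, y, hx0, hy0, hx, hy, hxy⟩ := g.exists_common_path (by simp) h.proj (a := a) (b := b)
    (by simp [StratGraph.proj, hb])
  have hplay : (A.prod (rankedUpd Γ (n := n))).IsPlay (fun n => h.pos (y n)) :=
    fun n => h.edge_of_step _ _ (hy n)
  have hpos : ∀ n, g.pos (x n) = (h.pos (y n)).1 := hxy
  have hopen : (fun n => (h.pos (y n)).2.1) = openSeq Γ (fun n => (h.pos (y n)).1) := by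
    refine eq_openSeq ?_ fun n => ?_
    · simp only [hy0, hb]
    · rw [(hplay n).2]
      rfl
  refine (key _ hplay).1 ?_ (hh y hy)
  have := hg x hx0 hx
  simp only [hpos, ← hopen] at this
  exact this

/-- Strategies that are winning in the bounded game win the relaxed condition. -/
theorem graph_path_relaxedStreett {A : Arena V} {Γ : StreettPairs V d}
    {cst : Fin d → CostFunction V} {σ : Strategy A .zero} {v : V}
    (hσ : (boundedStreettGameWithCosts A Γ cst).IsWinningFrom σ {v}) (x : ℕ → List V × V)
    (hx0 : x 0 = ([], v)) (hx : σ.graph.IsPath x) :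
    (fun n => (σ.graph.pos (x n), openSeq Γ (fun n => σ.graph.pos (x n)) n)) ∈
      relaxedStreett Γ cst := by
  have h := σ.graph_path hx (by simp [hx0])
  exact mem_relaxedStreett_of_mem_bndCostStreett (hσ _ h.1 (by simp only [hx0]; rfl) h.2)

/-- Player 0 has a finite-memory winning set in the bounded game that contains all vertices from
which she can win, or from which she can satisfy the relaxed condition. -/
theorem exists_memWin_bounded [Finite V] (A : Arena V) (Γ : StreettPairs V d)
    (cst : Fin d → CostFunction V) (n : ℕ) :
    ∃ nxt G, MemWin A .zero (rankedUpd Γ (n := n)) nxt G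
      {z | (fun n => (z n).1) ∈ costStreett Γ cst ∧
      ((z 0).2.1 = openInit Γ (z 0).1 → (fun n => (z n).1) ∈ bndCostStreett Γ cst)} ∧
      (∀ v ∈ (boundedStreettGameWithCosts A Γ cst).winningRegion .zero,
        ∀ π : Fin d ⊕ Fin d ≃ Fin n, (v, openInit Γ v, π) ∈ G) ∧
      ∀ (α : Type u) (g : StratGraph A .zero α) (a : α) (π : Fin d ⊕ Fin d ≃ Fin n),
        (∀ x, x 0 = a → g.IsPath x →
          (fun n => (g.pos (x n), openSeq Γ (fun n => g.pos (x n)) n)) ∈ relaxedStreett Γ cst) →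
        (g.pos a, openInit Γ (g.pos a), π) ∈ G := by
  obtain ⟨nxt, G, hG, hin⟩ := exists_memWin_zero A Γ cst n
  refine ⟨nxt, G, hG.costStreett_of_relaxedStreett (fun _ _ => rfl), ?_, hin⟩
  rintro v ⟨σ, hσ⟩ π
  exact hin _ σ.graph ([], v) π (graph_path_relaxedStreett hσ)

/-- Player 1 wins the bounded game uniformly with the sets of open requests as memory. -/
theorem exists_uniform_one [Finite V] (A : Arena V) (Γ : StreettPairs V d)
    (cst : Fin d → CostFunction V) :
    (boundedStreettGameWithCosts A Γ cst).HasUniformFiniteStateWinningStrategy .one (2 ^ d) := by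
  obtain ⟨f, G, hG, hout⟩ := exists_posWin_compl_streettSeq (p := .one) (q := .zero) (by simp)
    (trackReq Γ cst) (fun i _ t => trackResp Γ i t) (A.prod (openUpd Γ))
  have hopen : ∀ z, (A.prod (openUpd Γ)).IsPlay z → (z 0).2 = openInit Γ (z 0).1 →
      z = fun n => ((z n).1, openSeq Γ (fun n => (z n).1) n) := by
    intro z hz h0
    rw [← eq_openSeq (R := fun n => (z n).2) h0 (fun n => (hz n).2)]
  obtain ⟨nx, hnx⟩ := MemWin.exists_nextMove (G := boundedStreettGameWithCosts A Γ cst)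
    hG.memWin (openInit Γ) (by
      intro z hz hplay h0 hbnd
      refine hz ?_
      rw [hopen z hplay h0]
      exact mem_relaxedStreett_of_mem_bndCostStreett hbnd)
  refine ⟨Finset (Fin d), inferInstance, ⟨openInit Γ, openUpd Γ⟩, nx, by simp, ?_⟩
  intro ρ hρ h0 hc
  refine hnx ρ hρ ?_ hc
  by_contra hmem
  -- Outside `G`, Player 0 can satisfy the relaxed condition. Hence she wins the bounded game by a
  -- finite-state strategy, contradicting that Player 1 wins from `ρ 0`.
  obtain ⟨α, g, a, ha, hg⟩ := hout _ hmem
  obtain ⟨nxt, S, hS, -, hin⟩ := exists_memWin_bounded A Γ cst (d + d)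
  have hSa := hin α g.proj a finSumFinEquiv (by
    intro x hx0 hx
    have := hg x hx
    rw [hopen _ (fun n => g.edge_of_step _ _ (hx n)) (by simp only [hx0, ha])] at this
    exact this)
  obtain ⟨nx', hnx'⟩ := hS.exists_nextMove (G := boundedStreettGameWithCosts A Γ cst)
    (fun v => (openInit Γ v, finSumFinEquiv)) (by
      intro z hz _ h0
      exact hz.2 (by rw [h0]))
  refine (boundedStreettGameWithCosts A Γ cst).disjoint_winningRegion (ρ 0)
    ⟨hnx'.mem_winningRegion ?_, h0⟩
  rwa [show g.proj.pos a = ρ 0 by simp [StratGraph.proj, ha]] at hSa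

theorem card_memory (d : ℕ) :
    Fintype.card (Finset (Fin d) × (Fin d ⊕ Fin d ≃ Fin (d + d))) =
      2 ^ d * Nat.factorial (2 * d) := by
  rw [Fintype.card_prod, Fintype.card_equiv finSumFinEquiv]
  simp [two_mul]

/-- Player 0 wins the bounded game uniformly with open requests and rankings as memory. -/
theorem exists_uniform_zero_bounded [Finite V] (A : Arena V) (Γ : StreettPairs V d)
    (cst : Fin d → CostFunction V) :
    (boundedStreettGameWithCosts A Γ cst).HasUniformFiniteStateWinningStrategy .zero
      (2 ^ d * Nat.factorial (2 * d)) := by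
  obtain ⟨nxt, S, hS, hin, -⟩ := exists_memWin_bounded A Γ cst (d + d)
  obtain ⟨nx, hnx⟩ := hS.exists_nextMove (G := boundedStreettGameWithCosts A Γ cst)
    (fun v => (openInit Γ v, finSumFinEquiv)) (by
      intro z hz _ h0
      exact hz.2 (by rw [h0]))
  exact ⟨_, inferInstance, ⟨_, rankedUpd Γ⟩, nx, card_memory d,
    fun ρ hρ h0 hc => hnx ρ hρ (hin _ h0 _) hc⟩

end Solution

/-! ### Prefix independence of the cost condition. -/

section PrefixIndependence

variable {V : Type u} {d : ℕ}

theorem infixCost_add (cst : CostFunction V) (ρ : ℕ → V) (m k k' : ℕ) :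
    infixCost cst (fun n => ρ (n + m)) k k' = infixCost cst ρ (k + m) (k' + m) := by
  rw [infixCost, infixCost, ← Finset.sum_Ico_add']
  refine Finset.sum_congr rfl fun j _ => ?_
  rw [Nat.add_right_comm]

theorem infixCost_mono (cst : CostFunction V) (ρ : ℕ → V) {k k₁ k₂ : ℕ} (h : k₁ ≤ k₂) :
    infixCost cst ρ k k₁ ≤ infixCost cst ρ k k₂ :=
  Finset.sum_le_sum_of_subset (Finset.Ico_subset_Ico_right h)

theorem exists_le_infixCost {cst : CostFunction V} {ρ : ℕ → V} {k : ℕ}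
    (h : {j | k ≤ j ∧ cst (ρ j) (ρ (j + 1)) = Label.inc}.Infinite) (b : ℕ) :
    ∃ k', k < k' ∧ b ≤ infixCost cst ρ k k' := by
  classical
  obtain ⟨t, ht, hcard⟩ := h.exists_subset_card_eq b
  -- The first bound makes `k < k'` even when `t` is empty; the second places all of `t` before
  -- `k'`.
  refine ⟨max (k + 1) (t.sup id + 1), by omega, ?_⟩
  rw [infixCost_eq_card, ← hcard]
  refine Finset.card_le_card fun j hj => ?_
  have h1 := ht hj
  have h2 : j ≤ t.sup id := Finset.le_sup (f := id) hj
  simp only [Finset.mem_filter, Finset.mem_Ico]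
  exact ⟨⟨h1.1, by omega⟩, h1.2⟩

theorem stCorPair_add (Γ : StreettPairs V d) (cst : Fin d → CostFunction V) (ρ : ℕ → V)
    (c : Fin d) (m k : ℕ) :
    stCorPair Γ cst (fun n => ρ (n + m)) c k = stCorPair Γ cst ρ c (k + m) := by
  unfold stCorPair
  split_ifs
  · simp only [infixCost_add]
    refine le_antisymm (le_iInf₂ fun j hj => ?_) (le_iInf₂ fun j hj => ?_)
    · obtain ⟨i, rfl⟩ : ∃ i, j = i + m := ⟨j - m, by omega⟩
      exact iInf₂_le (f := fun i (_ : k ≤ i ∧ ρ (i + m) ∈ Γ.P c) =>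
        (infixCost (cst c) ρ (k + m) (i + m) : ℕ∞)) i ⟨by omega, hj.2⟩
    · exact iInf₂_le (f := fun i (_ : k + m ≤ i ∧ ρ i ∈ Γ.P c) =>
        (infixCost (cst c) ρ (k + m) i : ℕ∞)) (j + m) ⟨by omega, hj.2⟩
  · rfl

/-- The cost-Streett condition is prefix-independent. -/
theorem mem_costStreett_add_iff {Γ : StreettPairs V d} {cst : Fin d → CostFunction V} {ρ : ℕ → V}
    (m : ℕ) : (fun n => ρ (n + m)) ∈ costStreett Γ cst ↔ ρ ∈ costStreett Γ cst := by
  have h : stCor Γ cst (fun n => ρ (n + m)) = fun k => stCor Γ cst ρ (k + m) := by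
    funext k
    simp only [stCor, stCorPair_add]
  change Filter.limsup (stCor Γ cst fun n => ρ (n + m)) atTop < ⊤ ↔ _
  rw [h, Filter.limsup_nat_add]
  rfl

end PrefixIndependence

/-! ### From the cost condition to the bounded game. -/

section BoundedVertex

variable {V : Type u} {d : ℕ}

theorem Strategy.exists_play {A : Arena V} {p : Player} (σ : Strategy A p) (v : V) :
    ∃ ρ, A.IsPlay ρ ∧ ρ 0 = v ∧ σ.Consistent ρ := by
  obtain ⟨x, hx0, hx⟩ := exists_path_of_forall_exists σ.graph.step (fun s => by
    by_cases h : A.owner (σ.graph.pos s) = p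
    · exact σ.graph.own s h
    · obtain ⟨u, hu⟩ := A.exists_edge (σ.graph.pos s)
      obtain ⟨t, ht, -⟩ := σ.graph.opp s h u hu
      exact ⟨t, ht⟩) ([], v)
  have h := σ.graph_path hx (by simp [hx0])
  exact ⟨_, h.1, by simp [hx0], h.2⟩

/-- The strategy that plays as `σ` does after the history `h`. -/
def Strategy.shift {A : Arena V} {p : Player} (σ : Strategy A p) (h : List V) : Strategy A p where
  move w v := σ.move (h ++ w) v
  legal w v hv := σ.legal (h ++ w) v hv

/-- Replacing the suffix of a consistent play by a play consistent with the shifted strategy. -/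
theorem Strategy.Consistent.splice {A : Arena V} {p : Player} {σ : Strategy A p} {ρ ρ' : ℕ → V}
    (hρ : A.IsPlay ρ) (hc : σ.Consistent ρ) {k : ℕ} (hρ' : A.IsPlay ρ') (h0 : ρ' 0 = ρ k)
    (hc' : (σ.shift ((List.range k).map ρ)).Consistent ρ') :
    ∃ τ, A.IsPlay τ ∧ σ.Consistent τ ∧ (∀ i ≤ k, τ i = ρ i) ∧ ∀ i, τ (i + k) = ρ' i := by
  let τ : ℕ → V := fun i => if i < k then ρ i else ρ' (i - k)
  have h1 : ∀ i ≤ k, τ i = ρ i := by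
    intro i hi
    rcases hi.lt_or_eq with h | rfl
    · simp [τ, h]
    · simp [τ, h0]
  have h2 : ∀ i, τ (i + k) = ρ' i := fun i => by simp [τ]
  refine ⟨τ, fun n => ?_, fun n hn => ?_, h1, h2⟩
  · rcases Nat.lt_or_ge n k with h | h
    · rw [h1 n h.le, h1 (n + 1) h]
      exact hρ n
    · obtain ⟨m, rfl⟩ : ∃ m, n = m + k := ⟨n - k, by omega⟩
      rw [Nat.add_right_comm, h2, h2]
      exact hρ' m
  · rcases Nat.lt_or_ge n k with h | h
    · rw [h1 n h.le] at hn ⊢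
      rw [h1 (n + 1) h, hc n hn]
      congr 1
      refine List.map_congr_left fun i hi => ?_
      rw [h1 i (by have := List.mem_range.1 hi; omega)]
    · obtain ⟨m, rfl⟩ : ∃ m, n = m + k := ⟨n - k, by omega⟩
      rw [h2] at hn ⊢
      rw [Nat.add_right_comm, h2, hc' m hn]
      change σ.move _ _ = σ.move _ _
      congr 1
      rw [Nat.add_comm m k, List.range_add, List.map_append, List.map_map]
      congr 1
      · refine List.map_congr_left fun i hi => ?_
        rw [h1 i (by have := List.mem_range.1 hi; omega)]
      · refine List.map_congr_left fun i _ => ?_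
        rw [Function.comp_apply, Nat.add_comm k i, h2]

/-- If Player 0 wins the Streett game with costs from `v`, then some consistent play visits a
vertex from which she wins the bounded game: otherwise, plays with unanswered requests of
increasing costs can be diagonalized. -/
theorem exists_mem_winningRegion_bounded {A : Arena V} {Γ : StreettPairs V d}
    {cst : Fin d → CostFunction V} {σ : Strategy A .zero} {v : V}
    (hσ : (streettGameWithCosts A Γ cst).IsWinningFrom σ {v}) :
    ∃ ρ, A.IsPlay ρ ∧ ρ 0 = v ∧ ∃ k,
      ρ k ∈ (boundedStreettGameWithCosts A Γ cst).winningRegion .zero := by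
  by_contra hno
  push Not at hno
  -- A state consists of a consistent play, the length of the prefix already committed to, and the
  -- cost to be exceeded or met next.
  let S := {s : (ℕ → V) × ℕ × ℕ // A.IsPlay s.1 ∧ s.1 0 = v ∧ σ.Consistent s.1}
  have hstep : ∀ s : S, ∃ t : S, t.1.2.2 = s.1.2.2 + 1 ∧ s.1.2.1 < t.1.2.1 ∧
      (∀ i ≤ s.1.2.1, t.1.1 i = s.1.1 i) ∧ ∃ c r, s.1.2.1 ≤ r ∧ r < t.1.2.1 ∧ t.1.1 r ∈ Γ.Q c ∧
      (∀ i, r ≤ i → t.1.1 i ∉ Γ.P c) ∧ s.1.2.2 ≤ infixCost (cst c) t.1.1 r t.1.2.1 := by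
    rintro ⟨⟨ρ, k, b⟩, hρ, h0, hc⟩
    have hk := hno ρ hρ h0 k
    have hk' : ¬ (boundedStreettGameWithCosts A Γ cst).IsWinningFrom
        (σ.shift ((List.range k).map ρ)) {ρ k} := fun h => hk ⟨_, h⟩
    simp only [Game.IsWinningFrom, not_forall] at hk'
    obtain ⟨ρ', hρ', h0', hc', hlose⟩ := hk'
    obtain ⟨τ, hτ, hτc, hτρ, hτρ'⟩ := Strategy.Consistent.splice hρ hc hρ' h0' hc'
    have hτ0 : τ 0 = v := by rw [hτρ 0 (Nat.zero_le _), ← h0]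
    -- The continuation still satisfies the cost condition, so it can only lose the bounded game
    -- through an unanswered request of infinite cost.
    have hcost : ρ' ∈ costStreett Γ cst := by
      rw [show ρ' = fun n => τ (n + k) from (funext hτρ').symm, mem_costStreett_add_iff]
      exact hσ τ hτ hτ0 hτc
    have hun : ∃ r, UnansweredWithInfiniteCost Γ cst ρ' r := by
      by_contra hun
      push Not at hun
      exact hlose ⟨hcost, hun⟩
    obtain ⟨r, c, hQ, htop, hinf⟩ := hun
    obtain ⟨k', hk', hb⟩ := exists_le_infixCost hinf b
    refine ⟨⟨⟨τ, k' + k, b + 1⟩, hτ, hτ0, hτc⟩, rfl, by simp only; omega, hτρ, c, r + k,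
      by simp only; omega, by simp only; omega, by simpa only [hτρ'] using hQ, fun i hi hP => ?_, ?_⟩
    · obtain ⟨j, rfl⟩ : ∃ j, i = j + k := ⟨i - k, by omega⟩
      have hP' : ρ' j ∈ Γ.P c := by
        rw [← hτρ']
        exact hP
      have := stCorPair_le (cst := cst) (show r ≤ j by omega) hP'
      rw [htop] at this
      exact absurd this (by simp)
    · simp only [← infixCost_add, hτρ']
      exact hb
  obtain ⟨ρ₀, hρ₀, h0, hc₀⟩ := σ.exists_play v
  obtain ⟨x, hx0, hx⟩ := exists_path_of_forall_exists _ hstep ⟨⟨ρ₀, 0, 0⟩, hρ₀, h0, hc₀⟩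
  have hb : ∀ n, (x n).1.2.2 = n := by
    intro n
    induction n with
    | zero => rw [hx0]
    | succ n ih => rw [(hx n).1, ih]
  have hmono : StrictMono fun n => (x n).1.2.1 := strictMono_nat_of_lt_succ fun n => (hx n).2.1
  have hle : ∀ n, n ≤ (x n).1.2.1 := hmono.id_le
  have hagree : ∀ n m, n ≤ m → ∀ i ≤ (x n).1.2.1, (x m).1.1 i = (x n).1.1 i := by
    intro n m hnm i hi
    induction m, hnm using Nat.le_induction with
    | base => rfl
    | succ m hm ih => rw [(hx m).2.2.1 i (hi.trans (hmono.monotone hm)), ih]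
  -- The limit of the committed prefixes; the `n`-th has length at least `n`, so the diagonal is
  -- well determined.
  let τ : ℕ → V := fun i => (x i).1.1 i
  have hτ : ∀ n i, i ≤ (x n).1.2.1 → τ i = (x n).1.1 i := by
    intro n i hi
    rw [← hagree n (max n i) (le_max_left _ _) i hi]
    exact (hagree i (max n i) (le_max_right _ _) i (hle i)).symm
  have hτ' : ∀ n i, i ≤ n → τ i = (x n).1.1 i := fun n i hi => hτ n i (hi.trans (hle n))
  have hplay : A.IsPlay τ := by
    intro n
    rw [hτ' (n + 1) n (by omega), hτ' (n + 1) (n + 1) le_rfl]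
    exact (x (n + 1)).2.1 n
  have hcons : σ.Consistent τ := by
    intro n hn
    rw [hτ' (n + 1) n (by omega)] at hn ⊢
    rw [hτ' (n + 1) (n + 1) le_rfl, (x (n + 1)).2.2.2 n hn]
    congr 1
    refine List.map_congr_left fun i hi => ?_
    rw [hτ' (n + 1) i (by have := List.mem_range.1 hi; omega)]
  have hwin := hσ τ hplay (x 0).2.2.1 hcons
  obtain ⟨b, hev⟩ := limsup_lt_top_iff.1 hwin
  obtain ⟨K, hK⟩ := Filter.eventually_atTop.1 hev
  -- The part `K` places the request where the bound `b` applies; the part `b + 1` makes its cost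
  -- exceed that bound.
  set n := max K (b + 1) with hn
  obtain ⟨c, r, hr, hr', hQ, hP, hcost⟩ := (hx n).2.2.2
  rw [hb] at hcost
  have hrK : K ≤ r := by
    have := hle n
    omega
  have h1 : stCorPair Γ cst τ c r ≤ b := (le_iSup (fun c => stCorPair Γ cst τ c r) c).trans (hK r hrK)
  have h2 : (n : ℕ∞) ≤ stCorPair Γ cst τ c r := by
    rw [stCorPair, if_pos (by rw [hτ (n + 1) r hr'.le]; exact hQ)]
    refine le_iInf₂ fun t ht => ?_
    have ht' : (x (n + 1)).1.2.1 < t := by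
      by_contra hlt
      rw [not_lt] at hlt
      refine hP t ht.1 ?_
      rw [← hτ (n + 1) t hlt]
      exact ht.2
    have h3 : infixCost (cst c) τ r (x (n + 1)).1.2.1 =
        infixCost (cst c) (x (n + 1)).1.1 r (x (n + 1)).1.2.1 := by
      refine Finset.sum_congr rfl fun j hj => ?_
      have := Finset.mem_Ico.1 hj
      rw [hτ (n + 1) j (by omega), hτ (n + 1) (j + 1) (by omega)]
    have h4 := infixCost_mono (cst c) τ (k := r) ht'.le
    exact_mod_cast hcost.trans (h3.symm.le.trans h4)
  have h5 : n ≤ b := by exact_mod_cast h2.trans h1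
  omega

end BoundedVertex

/-! ### Gluing finite-memory winning sets. -/

section Union

variable {V : Type u}

/-- A finite-memory winning set for a prefix-independent condition is extended by a disjoint set
of states that can only be left into it. -/
theorem MemWin.extend {M : Type w} [Nonempty M] {A : Arena V} {p : Player} {upd upd' : M → V → M}
    {nxt nxt' : V → M → V} {G G' : Set (V × M)} {Ω : Set (ℕ → V)}
    (hΩ : ∀ ρ k, (fun n => ρ (n + k)) ∈ Ω → ρ ∈ Ω)
    (h : MemWin A p upd nxt G {z | (fun n => (z n).1) ∈ Ω})
    (hdisj : ∀ v m, (v, m) ∈ G' → v ∉ Prod.fst '' G)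
    (hown : ∀ v m, (v, m) ∈ G' → A.owner v = p → A.edge v (nxt' v m) ∧
      (nxt' v m ∈ Prod.fst '' G ∨ (nxt' v m, upd' m (nxt' v m)) ∈ G'))
    (hopp : ∀ v m, (v, m) ∈ G' → A.owner v ≠ p → ∀ u, A.edge v u →
      u ∈ Prod.fst '' G ∨ (u, upd' m u) ∈ G')
    (hwin : ∀ z, (∀ n, z n ∈ G') → (A.prod upd').IsPlay z →
      (∀ n, A.owner (z n).1 = p → (z (n + 1)).1 = nxt' (z n).1 (z n).2) →
      (fun n => (z n).1) ∈ Ω) :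
    ∃ upd'' nxt'', MemWin A p upd'' nxt'' (G ∪ G') {z | (fun n => (z n).1) ∈ Ω} := by
  classical
  have hsel : ∀ u, ∃ m : M, u ∈ Prod.fst '' G → (u, m) ∈ G := by
    intro u
    by_cases hu : u ∈ Prod.fst '' G
    · obtain ⟨⟨u, m⟩, hm, rfl⟩ := hu
      exact ⟨m, fun _ => hm⟩
    · exact ⟨Classical.arbitrary M, fun h' => absurd h' hu⟩
  choose g hg using hsel
  -- On entering the vertices of `G`, the memory is reset to a state `g u` that puts the pair in
  -- `G`, unless `upd` already does so. Vertex sets are disjoint, so the current vertex tells which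
  -- strategy to use and no extra memory is needed.
  let upd'' : M → V → M := fun m u =>
    if u ∈ Prod.fst '' G then (if (u, upd m u) ∈ G then upd m u else g u) else upd' m u
  let nxt'' : V → M → V := fun v m => if v ∈ Prod.fst '' G then nxt v m else nxt' v m
  have hfst : ∀ {v m}, (v, m) ∈ G → v ∈ Prod.fst '' G := fun h => ⟨_, h, rfl⟩
  have hupd : ∀ {m u}, (u, upd m u) ∈ G → upd'' m u = upd m u := by
    intro m u hu
    simp only [upd'', if_pos (hfst hu), if_pos hu]
  have hent : ∀ {m u}, u ∈ Prod.fst '' G → (u, upd'' m u) ∈ G := by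
    intro m u hu
    simp only [upd'', if_pos hu]
    split_ifs with h'
    · exact h'
    · exact hg u hu
  have hmove : ∀ {m u}, (u ∈ Prod.fst '' G ∨ (u, upd' m u) ∈ G') → (u, upd'' m u) ∈ G ∪ G' := by
    intro m u hu
    by_cases hu' : u ∈ Prod.fst '' G
    · exact Or.inl (hent hu')
    · refine Or.inr ?_
      simp only [upd'', if_neg hu']
      exact hu.resolve_left hu'
  refine ⟨upd'', nxt'', ⟨?_, ?_, ?_⟩⟩
  · rintro v m (hv | hv) hp
    · simp only [nxt'', if_pos (hfst hv)]
      have := h.own v m hv hp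
      exact ⟨this.1, Or.inl (by rw [hupd this.2]; exact this.2)⟩
    · simp only [nxt'', if_neg (hdisj v m hv)]
      exact ⟨(hown v m hv hp).1, hmove (hown v m hv hp).2⟩
  · rintro v m (hv | hv) hp u hu
    · have := h.opp v m hv hp u hu
      exact Or.inl (by rw [hupd this]; exact this)
    · exact hmove (hopp v m hv hp u hu)
  · intro z hz hplay hf
    by_cases hex : ∃ N, z N ∈ G
    · obtain ⟨N, hN⟩ := hex
      have hstay : ∀ n, z (n + N) ∈ G ∧ (z (n + 1 + N)).2 = upd (z (n + N)).2 (z (n + 1 + N)).1 := by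
        have hnext : ∀ m, z m ∈ G → z (m + 1) ∈ G ∧ (z (m + 1)).2 = upd (z m).2 (z (m + 1)).1 := by
          intro m hm
          have key : ((z (m + 1)).1, upd (z m).2 (z (m + 1)).1) ∈ G := by
            by_cases hp : A.owner (z m).1 = p
            · have h1 := hf m hp
              simp only [nxt'', if_pos (hfst hm)] at h1
              rw [h1]
              exact (h.own _ _ hm hp).2
            · exact h.opp _ _ hm hp _ (hplay m).1
          have h2 : (z (m + 1)).2 = upd (z m).2 (z (m + 1)).1 := by
            rw [(hplay m).2]
            exact hupd key
          exact ⟨by rw [← h2] at key; exact key, h2⟩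
        have hall : ∀ n, z (n + N) ∈ G := by
          intro n
          induction n with
          | zero => simpa using hN
          | succ n ih =>
            rw [Nat.add_right_comm]
            exact (hnext _ ih).1
        refine fun n => ⟨hall n, ?_⟩
        rw [Nat.add_right_comm]
        exact (hnext _ (hall n)).2
      refine hΩ _ N (h.win (fun n => z (n + N)) (fun n => (hstay n).1) (fun n => ⟨?_, (hstay n).2⟩)
        fun n hp => ?_)
      · simp only [Nat.add_right_comm n 1 N]
        exact (hplay _).1
      · have h1 := hf (n + N) hp
        simp only [nxt'', if_pos (hfst (hstay n).1)] at h1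
        rw [Nat.add_right_comm]
        exact h1
    · have hG' : ∀ n, z n ∈ G' := fun n => (hz n).resolve_left fun h' => hex ⟨n, h'⟩
      refine hwin z hG' (fun n => ⟨(hplay n).1, ?_⟩) fun n hp => ?_
      · rw [(hplay n).2]
        simp only [upd'', if_neg (hdisj _ _ (hG' (n + 1)))]
      · rw [hf n hp]
        simp only [nxt'', if_neg (hdisj _ _ (hG' n))]

/-- The arena in which `Z` cannot be left. -/
def Arena.restrict (A : Arena V) (Z : Set V) (hZ : ∀ v ∈ Z, ∃ u ∈ Z, A.edge v u) : Arena V where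
  owner := A.owner
  edge v u := A.edge v u ∧ (v ∈ Z → u ∈ Z)
  exists_edge v := by
    by_cases hv : v ∈ Z
    · obtain ⟨u, hu, hvu⟩ := hZ v hv
      exact ⟨u, hvu, fun _ => hu⟩
    · obtain ⟨u, hu⟩ := A.exists_edge v
      exact ⟨u, hu, fun h => absurd h hv⟩

end Union

/-! ### The unbounded game and the main theorem. -/

variable {V : Type u} {d : ℕ}

/-- Player 0 wins the Streett game with costs from her whole winning region with the memory for
the bounded game. -/
theorem exists_memWin_costStreett [Finite V] (A : Arena V) (Γ : StreettPairs V d)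
    (cst : Fin d → CostFunction V) :
    ∃ upd nxt, ∃ G : Set (V × Finset (Fin d) × (Fin d ⊕ Fin d ≃ Fin (d + d))),
      MemWin A .zero upd nxt G {z | (fun n => (z n).1) ∈ costStreett Γ cst} ∧
      (streettGameWithCosts A Γ cst).winningRegion .zero ⊆ Prod.fst '' G := by
  let Good : Set V → Prop := fun Y => ∃ upd nxt,
    ∃ G : Set (V × Finset (Fin d) × (Fin d ⊕ Fin d ≃ Fin (d + d))),
      MemWin A .zero upd nxt G {z | (fun n => (z n).1) ∈ costStreett Γ cst} ∧ Prod.fst '' G = Y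
  let m₀ : Finset (Fin d) × (Fin d ⊕ Fin d ≃ Fin (d + d)) := (∅, finSumFinEquiv)
  have hΩ : ∀ ρ k, (fun n => ρ (n + k)) ∈ costStreett Γ cst → ρ ∈ costStreett Γ cst :=
    fun ρ k => (mem_costStreett_add_iff k).1
  have hempty : Good ∅ := by
    refine ⟨fun _ _ => m₀, fun v _ => v, ∅, ⟨by simp, by simp, fun z hz => absurd (hz 0) (by simp)⟩,
      by simp⟩
  obtain ⟨Y, hY⟩ : ∃ Y, Maximal Good Y := (Set.toFinite {Y | Good Y}).exists_maximal ⟨∅, hempty⟩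
  obtain ⟨upd, nxt, G, hG, hGY⟩ := hY.1
  refine ⟨upd, nxt, G, hG, ?_⟩
  -- By maximality of `Y`, every admissible extension is empty.
  have hext : ∀ (upd' : Finset (Fin d) × (Fin d ⊕ Fin d ≃ Fin (d + d)) → V →
      Finset (Fin d) × (Fin d ⊕ Fin d ≃ Fin (d + d)))
      (nxt' : V → Finset (Fin d) × (Fin d ⊕ Fin d ≃ Fin (d + d)) → V) (G' : Set (V × Finset (Fin d) × (Fin d ⊕ Fin d ≃ Fin (d + d)))),
      (∀ v m, (v, m) ∈ G' → v ∉ Y) →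
      (∀ v m, (v, m) ∈ G' → A.owner v = .zero → A.edge v (nxt' v m) ∧
        (nxt' v m ∈ Y ∨ (nxt' v m, upd' m (nxt' v m)) ∈ G')) →
      (∀ v m, (v, m) ∈ G' → A.owner v ≠ .zero → ∀ u, A.edge v u → u ∈ Y ∨ (u, upd' m u) ∈ G') →
      (∀ z, (∀ n, z n ∈ G') → (A.prod upd').IsPlay z →
        (∀ n, A.owner (z n).1 = .zero → (z (n + 1)).1 = nxt' (z n).1 (z n).2) →
        (fun n => (z n).1) ∈ costStreett Γ cst) → ∀ s, s ∉ G' := by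
    intro upd' nxt' G' h1 h2 h3 h4
    subst hGY
    have : Nonempty (Finset (Fin d) × (Fin d ⊕ Fin d ≃ Fin (d + d))) := ⟨m₀⟩
    obtain ⟨upd'', nxt'', hnew⟩ := hG.extend hΩ h1 h2 h3 h4
    have hle := hY.2 ⟨upd'', nxt'', _, hnew, rfl⟩ (Set.image_mono Set.subset_union_left)
    rintro ⟨v, m⟩ hvm
    exact h1 v m hvm (hle ⟨(v, m), Or.inr hvm, rfl⟩)
  -- Otherwise `v` alone could be added, as Player 0 can move into `Y` or Player 1 must. So Player 0
  -- cannot leave the complement of `Y`, and Player 1 can always stay in it.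
  have hattr : ∀ v, v ∉ Y → (A.owner v = .zero → ∀ u, A.edge v u → u ∉ Y) ∧
      (A.owner v ≠ .zero → ∃ u ∉ Y, A.edge v u) := by
    intro v hv
    constructor
    · intro hp u hu huY
      have := hext (fun _ _ => m₀) (fun _ _ => u) ({v} ×ˢ Set.univ)
        (by rintro w m ⟨rfl, -⟩; exact hv) (by rintro w m ⟨rfl, -⟩ -; exact ⟨hu, Or.inl huY⟩)
        (by rintro w m ⟨rfl, -⟩ hp'; exact absurd hp hp') (by
          intro z hz hplay hf
          have h0 : (z 0).1 = v := (hz 0).1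
          have h1 : (z 1).1 = v := (hz 1).1
          have h2 := hf 0 (by rw [h0]; exact hp)
          simp only [zero_add, h1] at h2
          exact absurd huY (h2 ▸ hv))
      exact this (v, m₀) ⟨rfl, trivial⟩
    · intro hp
      by_contra hall
      push Not at hall
      have hall' : ∀ u, A.edge v u → u ∈ Y := fun u hu => by
        by_contra hu'
        exact hall u hu' hu
      have := hext (fun _ _ => m₀) (fun v _ => v) ({v} ×ˢ Set.univ)
        (by rintro w m ⟨rfl, -⟩; exact hv) (by rintro w m ⟨rfl, -⟩ hp'; exact absurd hp' hp)
        (by rintro w m ⟨rfl, -⟩ - u hu; exact Or.inl (hall' u hu)) (by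
          intro z hz hplay hf
          have h0 : (z 0).1 = v := (hz 0).1
          have h1 : (z 1).1 = v := (hz 1).1
          have h2 := (hplay 0).1
          rw [zero_add, h0, h1] at h2
          exact absurd (hall' v h2) hv)
      exact this (v, m₀) ⟨rfl, trivial⟩
  rw [hGY]
  rintro v ⟨σ, hσ⟩
  by_contra hv
  have hZ : ∀ v ∈ Yᶜ, ∃ u ∈ Yᶜ, A.edge v u := by
    intro v hv
    by_cases hp : A.owner v = .zero
    · obtain ⟨u, hu⟩ := A.exists_edge v
      exact ⟨u, (hattr v hv).1 hp u hu, hu⟩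
    · exact (hattr v hv).2 hp
  let B := A.restrict Yᶜ hZ
  have hBstay : ∀ ρ, B.IsPlay ρ → ρ 0 ∈ Yᶜ → ∀ n, ρ n ∈ Yᶜ := by
    intro ρ hρ h0 n
    induction n with
    | zero => exact h0
    | succ n ih => exact (hρ n).2 ih
  let σ' : Strategy B .zero := ⟨σ.move, fun w u hu =>
    ⟨σ.legal w u hu, fun huY => (hattr u huY).1 hu _ (σ.legal w u hu)⟩⟩
  have hσ' : (streettGameWithCosts B Γ cst).IsWinningFrom σ' {v} :=
    fun ρ hρ h0 hc => hσ ρ (fun n => (hρ n).1) h0 hc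
  obtain ⟨ρ, hρ, h0, k, hk⟩ := exists_mem_winningRegion_bounded hσ'
  have hkY := hBstay ρ hρ (by rw [h0]; exact hv) k
  obtain ⟨nxt', S, hS, hin, -⟩ := exists_memWin_bounded B Γ cst (d + d)
  have hSk := hin _ hk finSumFinEquiv
  -- In `A`, the only additional moves from these states are moves of Player 1 into `Y`, so this is
  -- an admissible, nonempty extension.
  have := hext (rankedUpd Γ) nxt' {s | s ∈ S ∧ s.1 ∈ Yᶜ} (fun u m hu => hu.2)
    (fun u m hu hp => by
      have h1 := hS.own u m hu.1 hp
      exact ⟨h1.1.1, Or.inr ⟨h1.2, h1.1.2 hu.2⟩⟩)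
    (fun u m hu hp w hw => by
      by_cases hwY : w ∈ Y
      · exact Or.inl hwY
      · exact Or.inr ⟨hS.opp u m hu.1 hp w ⟨hw, fun _ => hwY⟩, hwY⟩)
    (fun z hz hplay hf => (hS.win z (fun n => (hz n).1)
      (fun n => ⟨⟨(hplay n).1, fun _ => (hz (n + 1)).2⟩, (hplay n).2⟩) hf).1)
  exact this _ ⟨hSk, hkY⟩

/-- Player 0 wins the Streett game with costs uniformly with open requests and rankings as
memory. -/
theorem exists_uniform_zero [Finite V] (A : Arena V) (Γ : StreettPairs V d)
    (cst : Fin d → CostFunction V) :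
    (streettGameWithCosts A Γ cst).HasUniformFiniteStateWinningStrategy .zero
      (2 ^ d * Nat.factorial (2 * d)) := by
  obtain ⟨upd, nxt, G, hG, hin⟩ := exists_memWin_costStreett A Γ cst
  have hsel : ∀ v, ∃ m, v ∈ Prod.fst '' G → (v, m) ∈ G := by
    intro v
    by_cases hv : v ∈ Prod.fst '' G
    · obtain ⟨⟨v, m⟩, hm, rfl⟩ := hv
      exact ⟨m, fun _ => hm⟩
    · exact ⟨(∅, finSumFinEquiv), fun h => absurd h hv⟩
  choose init hinit using hsel
  obtain ⟨nx, hnx⟩ := hG.exists_nextMove (G := streettGameWithCosts A Γ cst) init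
    fun z hz _ _ => hz
  exact ⟨_, inferInstance, ⟨init, upd⟩, nx, card_memory d,
    fun ρ hρ h0 hc => hnx ρ hρ (hinit _ (hin h0)) hc⟩

end StreettCosts

theorem mainTheorem12 {V : Type*} [Finite V] (A : StreettCosts.Arena V) (d : ℕ)
    (Γ : StreettCosts.StreettPairs V d) (cst : Fin d → StreettCosts.CostFunction V) :
    (StreettCosts.boundedStreettGameWithCosts A Γ cst).HasUniformFiniteStateWinningStrategy
        StreettCosts.Player.zero (2 ^ d * Nat.factorial (2 * d)) ∧
    (StreettCosts.streettGameWithCosts A Γ cst).HasUniformFiniteStateWinningStrategy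
        StreettCosts.Player.zero (2 ^ d * Nat.factorial (2 * d)) ∧
    (StreettCosts.boundedStreettGameWithCosts A Γ cst).HasUniformFiniteStateWinningStrategy
        StreettCosts.Player.one (2 ^ d) :=
  ⟨StreettCosts.exists_uniform_zero_bounded A Γ cst, StreettCosts.exists_uniform_zero A Γ cst,
    StreettCosts.exists_uniform_one A Γ cst⟩
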